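/- Let $A=(a_{ij})$ be a generalized Cartan matrix of size $n$ with realisation $(\mathfrak h,\Pi=\{\alpha_i\},\Pi^\vee=\{\alpha_i^\vee\})$ over $\mathbb C$, and let $\mathfrak g=\mathfrak g(A)$ be the associated Kac--Moody algebra (the quotient of the Lie algebra $\tilde{\mathfrak g}(A)$ generated by $\mathfrak h$ and $e_i,f_i$ with relations $[h,h']=0$, $[h,e_i]=\alpha_i(h)e_i$, $[h,f_i]=-\alpha_i(h)f_i$, $[e_i,f_j]=\delta_{ij}\alpha_i^\vee$ by its largest ideal meeting $\mathfrak h$ trivially). Let $Q$ be the root lattice, $Q^+=\sum_i\mathbb Z_{\ge0}\alpha_i$, $Q^-=-Q^+$; write $\alpha>0$ if $0\ne\alpha\in Q^+$ and $\alpha<0$ if $-\alpha>0$. For $\alpha\in Q$ let $m(\alpha)=\dim\mathfrak g_\alpha$, and let $\Phi^+$ be the set of positive roots, i.e. of $\alpha>0$ with $m(\alpha)\neq0$. Let $W\subset\mathrm{Aut}(\mathfrak h^*)$ be the Weyl group, generated by the simple reflections $s_i$, with length function $\ell$. Fix $\rho\in\mathfrak h^*$ with $\rho(\alpha_i^\vee)=1$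 for all $i$, and put $w\circ\lambda=w(\lambda+\rho)-\rho$. Define $H(\mu)=H(\mu;q)\in\mathbb Z[q]$ for $\mu\in Q^+$ by $$\sum_{\mu\in Q^+}H(\mu;q)e^{-\mu}=\prod_{\alpha\in\Phi^+}(1-qe^{-\alpha})^{m(\alpha)},$$ and $H(\mu)=0$ for $\mu\notin Q^+$. For $\mu\in Q^+$ let $\mathcal P(\mu)$ be the (finite) set of admissible partitions of $\mu$, i.e. of finite subsets $\mathfrak p$ of $\{(\alpha;i):\alpha\in\Phi^+,\ 1\le i\le m(\alpha)\}$ with $\sum_{(\alpha;i)\in\mathfrak p}\alpha=\mu$. For $w\in W$ put $$m(\mathfrak p,w)=|\mathfrak p|-2\cdot\#\{(\beta;j)\in\mathfrak p: w\beta<0\}.$$ **Proposition.** For every $\lambda\in Q^-$ and every $w\in W$, the following identity holds in $\mathbb Z[q,q^{-1}]$: $$(-1)^{\ell(w)}H(-w\circ\lambda)=q^{\ell(w)}\sum_{\mathfrak p\in\mathcal P(-\lambda)}(-q)^{m(\mathfrak p,w)}.$$ -/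

import Mathlib

open Module
open scoped LaurentPolynomial

noncomputable section

/-- A generalized Cartan matrix of size `n`. -/
structure GCM (n : ℕ) where
  toMatrix : Matrix (Fin n) (Fin n) ℤ
  diag : ∀ i, toMatrix i i = 2
  offDiag_nonpos : ∀ i j, i ≠ j → toMatrix i j ≤ 0
  zero_symm : ∀ i j, toMatrix i j = 0 → toMatrix j i = 0

/-- A realisation `(𝔥, Π, Π^∨)` over `ℂ` of a generalized Cartan matrix `A`: linearly independent
families `Π = (α_i)` in `𝔥*` and `Π^∨ = (α_i^∨)` in `𝔥` with `⟨α_i^∨, α_j⟩ = a_{ij}` and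
`n - rank A = dim 𝔥 - n`. -/
structure GCM.Realization {n : ℕ} (A : GCM n) (𝔥 : Type*) [AddCommGroup 𝔥] [Module ℂ 𝔥] where
  root : Fin n → Dual ℂ 𝔥
  coroot : Fin n → 𝔥
  linearIndependent_root : LinearIndependent ℂ root
  linearIndependent_coroot : LinearIndependent ℂ coroot
  root_coroot : ∀ i j, root j (coroot i) = (A.toMatrix i j : ℂ)
  finrank_add_rank :
    finrank ℂ 𝔥 + (A.toMatrix.map (Int.cast : ℤ → ℂ)).rank = 2 * n

/-- Generators of the auxiliary Lie algebra `𝔤̃(A)`: `e_i`, `f_i` and the elements of `𝔥`. -/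
inductive KMGenerator (n : ℕ) (𝔥 : Type*)
  | e : Fin n → KMGenerator n 𝔥
  | f : Fin n → KMGenerator n 𝔥
  | h : 𝔥 → KMGenerator n 𝔥

namespace GCM.Realization

variable {n : ℕ} {A : GCM n} {𝔥 : Type*} [AddCommGroup 𝔥] [Module ℂ 𝔥] (R : A.Realization 𝔥)

/-! ### The Kac--Moody algebra -/

/-- The generator `e_i` of the free Lie algebra. -/
def genE (n : ℕ) (𝔥 : Type*) (i : Fin n) : FreeLieAlgebra ℂ (KMGenerator n 𝔥) :=
  FreeLieAlgebra.of ℂ (KMGenerator.e i)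

/-- The generator `f_i` of the free Lie algebra. -/
def genF (n : ℕ) (𝔥 : Type*) (i : Fin n) : FreeLieAlgebra ℂ (KMGenerator n 𝔥) :=
  FreeLieAlgebra.of ℂ (KMGenerator.f i)

/-- The generator of the free Lie algebra given by `x ∈ 𝔥`. -/
def genH (n : ℕ) {𝔥 : Type*} (x : 𝔥) : FreeLieAlgebra ℂ (KMGenerator n 𝔥) :=
  FreeLieAlgebra.of ℂ (KMGenerator.h x)

/-- The defining relations of `𝔤̃(A)`, as elements of the free Lie algebra. The first two families
say that `𝔥 → 𝔤̃(A)` is linear. -/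
inductive Rel : FreeLieAlgebra ℂ (KMGenerator n 𝔥) → Prop
  | h_add (x y : 𝔥) : Rel (genH n (x + y) - genH n x - genH n y)
  | h_smul (c : ℂ) (x : 𝔥) : Rel (genH n (c • x) - c • genH n x)
  | hh (x y : 𝔥) : Rel ⁅genH n x, genH n y⁆
  | ef_same (i : Fin n) : Rel (⁅genE n 𝔥 i, genF n 𝔥 i⁆ - genH n (R.coroot i))
  | ef_diff (i j : Fin n) : i ≠ j → Rel ⁅genE n 𝔥 i, genF n 𝔥 j⁆
  | he (x : 𝔥) (i : Fin n) : Rel (⁅genH n x, genE n 𝔥 i⁆ - R.root i x • genE n 𝔥 i)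
  | hf (x : 𝔥) (i : Fin n) : Rel (⁅genH n x, genF n 𝔥 i⁆ + R.root i x • genF n 𝔥 i)

/-- The ideal generated by the defining relations. -/
def relIdeal : LieIdeal ℂ (FreeLieAlgebra ℂ (KMGenerator n 𝔥)) :=
  LieSubmodule.lieSpan ℂ _ {x | R.Rel x}

/-- The auxiliary Lie algebra `𝔤̃(A)`. -/
abbrev Aux : Type _ := FreeLieAlgebra ℂ (KMGenerator n 𝔥) ⧸ R.relIdeal

/-- The image of `x ∈ 𝔥` in `𝔤̃(A)`. -/
def auxCartan (x : 𝔥) : R.Aux :=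
  LieSubmodule.Quotient.mk (N := R.relIdeal) (genH n x)

/-- The largest ideal of `𝔤̃(A)` that intersects `𝔥` trivially. -/
def maxIdeal : LieIdeal ℂ R.Aux :=
  sSup {I : LieIdeal ℂ R.Aux | ∀ x : 𝔥, R.auxCartan x ∈ I → R.auxCartan x = 0}

/-- The Kac--Moody algebra `𝔤 = 𝔤(A)`. -/
abbrev KacMoody : Type _ := R.Aux ⧸ R.maxIdeal

/-- The image of `x ∈ 𝔥` in `𝔤`. -/
def cartan (x : 𝔥) : R.KacMoody :=
  LieSubmodule.Quotient.mk (N := R.maxIdeal) (R.auxCartan x)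

/-- The space `𝔤_α = {x | [h, x] = α(h) x for all h ∈ 𝔥}`. -/
def rootSpace (α : Dual ℂ 𝔥) : Submodule ℂ R.KacMoody :=
  ⨅ x : 𝔥, (LieAlgebra.ad ℂ R.KacMoody (R.cartan x)).eigenspace (α x)

/-- The multiplicity `m(α) = dim 𝔤_α`. -/
def mult (α : Dual ℂ 𝔥) : ℕ := finrank ℂ (R.rootSpace α)

/-! ### Root lattice, order and roots -/

/-- The root lattice `Q`. -/
def rootLattice : AddSubgroup (Dual ℂ 𝔥) := AddSubgroup.closure (Set.range R.root)

/-- The positive root cone `Q⁺`. -/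
def posCone : AddSubmonoid (Dual ℂ 𝔥) := AddSubmonoid.closure (Set.range R.root)

/-- The negative root cone `Q⁻ = -Q⁺`. -/
def negCone : Set (Dual ℂ 𝔥) := {μ | -μ ∈ R.posCone}

/-- `α > 0`. -/
def IsPos (α : Dual ℂ 𝔥) : Prop := α ∈ R.posCone ∧ α ≠ 0

/-- `α < 0`. -/
def IsNeg (α : Dual ℂ 𝔥) : Prop := α ∈ R.negCone ∧ α ≠ 0

/-- The set of roots `Φ`. -/
def roots : Set (Dual ℂ 𝔥) := {α | α ∈ R.rootLattice ∧ α ≠ 0 ∧ R.mult α ≠ 0}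

/-- The set of positive roots `Φ⁺`. -/
def posRoots : Set (Dual ℂ 𝔥) := {α | α ∈ R.roots ∧ R.IsPos α}

/-! ### Weyl group -/

/-- The simple reflection `s_i(μ) = μ - μ(α_i^∨) α_i` of `𝔥*`. -/
def simpleReflection (i : Fin n) : Dual ℂ 𝔥 ≃ₗ[ℂ] Dual ℂ 𝔥 :=
  Module.reflection (x := R.root i) (f := Dual.eval ℂ 𝔥 (R.coroot i))
    (by simp [R.root_coroot, A.diag])

/-- The Weyl group `W`. -/
def weylGroup : Subgroup (Dual ℂ 𝔥 ≃ₗ[ℂ] Dual ℂ 𝔥) :=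
  Subgroup.closure (Set.range R.simpleReflection)

/-- The length `ℓ(w)`: the least length of a word in the simple reflections with product `w`. -/
def length (w : Dual ℂ 𝔥 ≃ₗ[ℂ] Dual ℂ 𝔥) : ℕ :=
  sInf {k | ∃ l : List (Fin n), l.length = k ∧ (l.map R.simpleReflection).prod = w}

/-- `ρ` is a Weyl vector. -/
def IsWeylVector (ρ : Dual ℂ 𝔥) : Prop := ∀ i, ρ (R.coroot i) = 1

/-- The circle action `w ∘ μ = w(μ + ρ) - ρ`. -/
def circ (ρ : Dual ℂ 𝔥) (w : Dual ℂ 𝔥 ≃ₗ[ℂ] Dual ℂ 𝔥) (μ : Dual ℂ 𝔥) : Dual ℂ 𝔥 :=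
  w (μ + ρ) - ρ

/-! ### Coordinates on the positive root cone -/

/-- `∑ k_i α_i`. -/
def wt (k : Fin n →₀ ℕ) : Dual ℂ 𝔥 := ∑ i, k i • R.root i

theorem wt_add (k l : Fin n →₀ ℕ) : R.wt (k + l) = R.wt k + R.wt l := by
  simp [wt, add_smul, Finset.sum_add_distrib]

theorem wt_injective : Function.Injective R.wt := by
  intro k l h
  have h1 : ∑ i, ((k i : ℂ) - (l i : ℂ)) • R.root i = 0 := by
    simp only [sub_smul, Finset.sum_sub_distrib, Nat.cast_smul_eq_nsmul]
    exact sub_eq_zero.mpr h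
  ext i
  have := Fintype.linearIndependent_iff.mp R.linearIndependent_root _ h1 i
  exact_mod_cast sub_eq_zero.mp this

theorem mem_posCone_iff {μ : Dual ℂ 𝔥} : μ ∈ R.posCone ↔ ∃ k, R.wt k = μ := by
  constructor
  · intro h
    induction h using AddSubmonoid.closure_induction with
    | mem x hx =>
      obtain ⟨i, rfl⟩ := hx
      exact ⟨Finsupp.single i 1, by
        simp [wt, Finsupp.single_apply, ite_smul]⟩
    | zero => exact ⟨0, by simp [wt]⟩
    | add x y _ _ hx hy =>
      obtain ⟨k, rfl⟩ := hx
      obtain ⟨l, rfl⟩ := hy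
      exact ⟨k + l, R.wt_add k l⟩
  · rintro ⟨k, rfl⟩
    refine sum_mem fun i _ => nsmul_mem ?_ _
    exact AddSubmonoid.subset_closure ⟨i, rfl⟩

open Classical in
/-- The coordinates `k` of `μ = ∑ k_i α_i ∈ Q⁺` (and `0` if `μ ∉ Q⁺`). -/
def coords (μ : Dual ℂ 𝔥) : Fin n →₀ ℕ :=
  if h : ∃ k, R.wt k = μ then h.choose else 0

theorem coords_wt (k : Fin n →₀ ℕ) : R.coords (R.wt k) = k := by
  have h : ∃ l, R.wt l = R.wt k := ⟨k, rfl⟩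
  rw [coords, dif_pos h]
  exact R.wt_injective h.choose_spec

theorem wt_coords {μ : Dual ℂ 𝔥} (h : μ ∈ R.posCone) : R.wt (R.coords μ) = μ := by
  obtain ⟨k, rfl⟩ := R.mem_posCone_iff.mp h
  rw [coords_wt]

/-! ### The function `H` -/

/-- For `μ ∈ Q⁺`, the formal exponential `e^{-μ}`. Formal sums over `{e^{-μ} : μ ∈ Q⁺}` with
coefficients in `ℤ[q]` are power series in `e^{-α_1}, …, e^{-α_n}`. -/
def expNeg (μ : Dual ℂ 𝔥) : MvPowerSeries (Fin n) (Polynomial ℤ) :=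
  MvPowerSeries.monomial (R.coords μ) 1

/-- The factor `(1 - q e^{-α})^{m(α)}`. -/
def factor (α : Dual ℂ 𝔥) : MvPowerSeries (Fin n) (Polynomial ℤ) :=
  (1 - MvPowerSeries.C Polynomial.X * R.expNeg α) ^ R.mult α

open scoped MvPowerSeries.WithPiTopology in
/-- The formal product `∏_{α ∈ Φ⁺} (1 - q e^{-α})^{m(α)}`, an infinite product for the topology of
coefficientwise stabilisation. -/
def genSeries : MvPowerSeries (Fin n) (Polynomial ℤ) :=
  letI : TopologicalSpace (Polynomial ℤ) := ⊥
  ∏' α : R.posRoots, R.factor α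

theorem coords_le_of_coeff_ne_zero (s : Finset R.posRoots) (d : Fin n →₀ ℕ)
    (h : MvPowerSeries.coeff d (∏ α ∈ s, (R.factor α - 1)) ≠ 0) (α : R.posRoots) (hα : α ∈ s) :
    R.coords α ≤ d := by
  have h1 : R.expNeg α ∣ R.factor α - 1 := by
    have h2 := sub_dvd_pow_sub_pow (1 - MvPowerSeries.C Polynomial.X * R.expNeg α) 1 (R.mult α)
    rw [one_pow, sub_sub_cancel_left, neg_dvd] at h2
    exact (Dvd.intro_left _ rfl).trans h2
  obtain ⟨g, hg⟩ := h1.trans (Finset.dvd_prod_of_mem (fun α : R.posRoots => R.factor α - 1) hα)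
  rw [hg, expNeg, MvPowerSeries.coeff_monomial_mul] at h
  by_contra hle
  exact h (if_neg hle)

open scoped MvPowerSeries.WithPiTopology in
/-- The infinite product defining `genSeries` converges. -/
theorem multipliable_factor :
    letI : TopologicalSpace (Polynomial ℤ) := ⊥
    Multipliable fun α : R.posRoots => R.factor α := by
  let : TopologicalSpace (Polynomial ℤ) := ⊥
  have : DiscreteTopology (Polynomial ℤ) := ⟨rfl⟩
  have hsum : Summable fun s : Finset R.posRoots => ∏ α ∈ s, (R.factor α - 1) := by
    refine MvPowerSeries.WithPiTopology.summable_iff_summable_coeff.mpr fun d =>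
      summable_of_hasFiniteSupport ?_
    have hfin : {α : R.posRoots | R.coords α ≤ d}.Finite := by
      refine Set.Finite.of_injOn (f := fun α : R.posRoots => R.coords α) (t := Set.Iic d)
        (fun α hα => hα) ?_ (Set.finite_Iic d)
      intro α _ β _ hαβ
      apply Subtype.ext
      have := congrArg R.wt hαβ
      rwa [R.wt_coords α.2.2.1, R.wt_coords β.2.2.1] at this
    refine hfin.toFinset.powerset.finite_toSet.subset fun s hs => ?_
    rw [Finset.mem_coe, Finset.mem_powerset]
    intro α hα
    exact hfin.mem_toFinset.mpr (R.coords_le_of_coeff_ne_zero s d hs α hα)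
  have := multipliable_one_add_of_summable_prod hsum
  simpa using this

open Classical in
/-- `H(μ) ∈ ℤ[q]`: the coefficient of `e^{-μ}` in `∏_{α ∈ Φ⁺} (1 - q e^{-α})^{m(α)}`, so that
`H(μ) = 0` for `μ ∉ Q⁺`. -/
def H (μ : Dual ℂ 𝔥) : Polynomial ℤ :=
  if μ ∈ R.posCone then MvPowerSeries.coeff (R.coords μ) R.genSeries else 0

/-! ### Admissible partitions -/

/-- The set `𝒫 = {(α; i) : α ∈ Φ⁺, 1 ≤ i ≤ m(α)}`. -/
def parts : Set (Dual ℂ 𝔥 × ℕ) := {x | x.1 ∈ R.posRoots ∧ 1 ≤ x.2 ∧ x.2 ≤ R.mult x.1}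

/-- The set of admissible partitions of `μ`. -/
def admissible (μ : Dual ℂ 𝔥) : Set (Finset (Dual ℂ 𝔥 × ℕ)) :=
  {p | (p : Set (Dual ℂ 𝔥 × ℕ)) ⊆ R.parts ∧ ∑ x ∈ p, x.1 = μ}

theorem admissible_finite (μ : Dual ℂ 𝔥) : (R.admissible μ).Finite := by
  classical
  let S : Finset (Dual ℂ 𝔥 × ℕ) := ((Finset.Iic (R.coords μ)).image R.wt).biUnion
    fun β => (Finset.Iic (R.mult β)).image fun i => (β, i)
  refine S.powerset.finite_toSet.subset ?_
  rintro p ⟨hp, hsum⟩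
  rw [Finset.mem_coe, Finset.mem_powerset]
  intro x hx
  have hpos : ∀ y ∈ p, y.1 ∈ R.posCone := fun y hy => (hp hy).1.2.1
  obtain ⟨k, hk⟩ := R.mem_posCone_iff.mp (hpos x hx)
  obtain ⟨l, hl⟩ := R.mem_posCone_iff.mp
    (sum_mem (t := p.erase x) (f := fun y => y.1)
      fun y hy => hpos y (Finset.mem_of_mem_erase hy))
  have hμ : R.wt (k + l) = μ := by
    rw [wt_add, hk, hl, ← hsum, Finset.add_sum_erase p (fun y => y.1) hx]
  have hkl : R.coords μ = k + l := by rw [← hμ, coords_wt]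
  simp only [S, Finset.mem_biUnion, Finset.mem_image, Finset.mem_Iic]
  exact ⟨x.1, ⟨k, by rw [hkl]; exact le_self_add, hk⟩, x.2, (hp hx).2.2, rfl⟩

/-- The set `𝒫(μ)` of admissible partitions of `μ`, as a finite set. -/
def partitions (μ : Dual ℂ 𝔥) : Finset (Finset (Dual ℂ 𝔥 × ℕ)) :=
  (R.admissible_finite μ).toFinset

open Classical in
/-- `m(𝔭, w) = |𝔭| - 2 · #{(β; j) ∈ 𝔭 : wβ < 0}`. -/
def mExp (p : Finset (Dual ℂ 𝔥 × ℕ)) (w : Dual ℂ 𝔥 ≃ₗ[ℂ] Dual ℂ 𝔥) : ℤ :=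
  (p.card : ℤ) - 2 * ((p.filter fun x => R.IsNeg (w x.1)).card : ℤ)

end GCM.Realization

/-- The unit `-q` of `ℤ[q, q⁻¹]`. -/
def negQ : (ℤ[T;T⁻¹])ˣ where
  val := -LaurentPolynomial.T 1
  inv := -LaurentPolynomial.T (-1)
  val_inv := by rw [neg_mul_neg, ← LaurentPolynomial.T_add]; simp
  inv_val := by rw [neg_mul_neg, ← LaurentPolynomial.T_add]; simp

end

/-! Expanding the product gives `H(μ) = ∑ (-q)^{|𝔭|}` over admissible partitions `𝔭` of `μ`
(`H_eq_sum`), so the identity reduces to a bijection between `𝒫(-λ)` and `𝒫(-w∘λ)`.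

Let `N` be the set of positive roots that `w` makes negative. It has `ℓ(w)` elements, each of
multiplicity one, and `∑_{β ∈ N} wβ = wρ - ρ` (`exists_inversions`). Regard `N` as a partition with
all indices `1`. Send `𝔭` to the image of the symmetric difference `𝔭 ∆ N` under `(β; j) ↦ (±wβ;
j)`, the sign making the root positive. Elements of `𝔭 \ N` contribute `wβ` and those of `N \ 𝔭`
contribute `-wβ`, so the new sum is `w(-λ) - (wρ - ρ) = -w∘λ`. The new size is `|𝔭| + ℓ(w) - 2|𝔭 ∩
N| = ℓ(w) + m(𝔭, w)`. This is `sum_partitions_circ`; the factor `(-1)^{ℓ(w)}` turns `(-q)^{ℓ(w)}`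
into `q^{ℓ(w)}`.

The rest establishes, from the presentation of `𝔤(A)`, the facts on roots that this uses. Sorting
iterated brackets by weight shows that roots are positive or negative and that the only positive
multiple of `α_i` that is a root is `α_i` itself. Verma modules show that `𝔥` embeds in `𝔤̃(A)`,
hence in `𝔤(A)`. The absence of nonzero ideals meeting `𝔥` trivially yields the Serre relations, so
`ad e_i` and `ad f_i` are locally nilpotent, and `exp(ad e_i) exp(-ad f_i) exp(ad e_i)` induces
`s_i` on weights. Therefore `m(wα) = m(α)` (`mult_apply`). The same lifts show that `wα_i = α_j`
implies `w s_i = s_j w`, which gives the exchange property and the description of `N`. -/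

noncomputable section

/-! ### Chevalley generators and weights of words. -/

namespace GCM.Realization

variable {n : ℕ} {A : GCM n} {𝔥 : Type*} [AddCommGroup 𝔥] [Module ℂ 𝔥]

/-- Elements `e_i`, `f_i` and a linear map from `𝔥` that generate the Lie algebra `L` and satisfy
the defining relations of `𝔤̃(A)`. -/
structure Chevalley (R : A.Realization 𝔥) (L : Type*) [LieRing L] [LieAlgebra ℂ L] where
  e : Fin n → L
  f : Fin n → L
  c : 𝔥 →ₗ[ℂ] L
  lie_c_c : ∀ x y, ⁅c x, c y⁆ = 0
  lie_c_e : ∀ x i, ⁅c x, e i⁆ = R.root i x • e i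
  lie_c_f : ∀ x i, ⁅c x, f i⁆ = -(R.root i x • f i)
  lie_e_f_same : ∀ i, ⁅e i, f i⁆ = c (R.coroot i)
  lie_e_f_diff : ∀ i j, i ≠ j → ⁅e i, f j⁆ = 0
  lieSpan_eq_top :
    LieSubalgebra.lieSpan ℂ L (Set.range e ∪ Set.range f ∪ Set.range c) = ⊤

/-- The weight `∑ α_{l_k}` of a word `l` in the simple roots. -/
def wordWeight (R : A.Realization 𝔥) (l : List (Fin n)) : Dual ℂ 𝔥 := (l.map R.root).sum

@[simp]
theorem wordWeight_nil (R : A.Realization 𝔥) : R.wordWeight [] = 0 := rfl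

@[simp] theorem wordWeight_cons (R : A.Realization 𝔥) (i : Fin n) (l : List (Fin n)) :
    R.wordWeight (i :: l) = R.root i + R.wordWeight l := by simp [wordWeight]

theorem wordWeight_mem_posCone (R : A.Realization 𝔥) (l : List (Fin n)) :
    R.wordWeight l ∈ R.posCone := by
  induction l with
  | nil => exact zero_mem _
  | cons i l ih =>
    rw [wordWeight_cons]
    exact add_mem (AddSubmonoid.subset_closure ⟨i, rfl⟩) ih

theorem root_ne_zero (R : A.Realization 𝔥) (i : Fin n) : R.root i ≠ 0 :=
  R.linearIndependent_root.ne_zero i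

theorem wt_eq_wt_iff (R : A.Realization 𝔥) (k l : Fin n → ℂ) :
    ∑ i, k i • R.root i = ∑ i, l i • R.root i ↔ k = l := by
  refine ⟨fun h => ?_, fun h => by rw [h]⟩
  have h1 : ∑ i, (k i - l i) • R.root i = 0 := by
    simp only [sub_smul, Finset.sum_sub_distrib, h, sub_self]
  ext i
  exact sub_eq_zero.mp (Fintype.linearIndependent_iff.mp R.linearIndependent_root _ h1 i)

theorem wordWeight_eq_sum (R : A.Realization 𝔥) (l : List (Fin n)) :
    R.wordWeight l = ∑ i, (l.count i : ℂ) • R.root i := by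
  induction l with
  | nil => simp
  | cons j l ih =>
    simp only [wordWeight_cons, ih, List.count_cons, beq_iff_eq, Nat.cast_add, add_smul,
      Finset.sum_add_distrib]
    rw [add_comm]
    simp

namespace Chevalley

variable {R : A.Realization 𝔥} {L : Type*} [LieRing L] [LieAlgebra ℂ L] (D : Chevalley R L)

/-- The Chevalley involution: exchange `e_i` and `f_i` and negate `𝔥`. -/
def swap : Chevalley R L where
  e := D.f
  f := D.e
  c := -D.c
  lie_c_c x y := by simp [D.lie_c_c]
  lie_c_e x i := by simp [D.lie_c_f]
  lie_c_f x i := by simp [D.lie_c_e]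
  lie_e_f_same i := by rw [← lie_skew, D.lie_e_f_same]; rfl
  lie_e_f_diff i j h := by rw [← lie_skew, D.lie_e_f_diff j i h.symm, neg_zero]
  lieSpan_eq_top := by
    rw [← D.lieSpan_eq_top]
    congr 1
    have : Set.range (-D.c) = Set.range D.c := by
      ext y
      constructor
      · rintro ⟨x, rfl⟩; exact ⟨-x, by simp⟩
      · rintro ⟨x, rfl⟩; exact ⟨-x, by simp⟩
    rw [this, Set.union_comm (Set.range D.f)]

@[simp] theorem swap_e : D.swap.e = D.f := rfl
@[simp] theorem swap_f : D.swap.f = D.e := rfl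
@[simp] theorem swap_c (x : 𝔥) : D.swap.c x = -D.c x := rfl
@[simp] theorem swap_swap : D.swap.swap = D := by
  obtain ⟨e, f, c, _⟩ := D
  simp [swap]

theorem lie_e_f (i j : Fin n) : ⁅D.e i, D.f j⁆ = if i = j then D.c (R.coroot i) else 0 := by
  split_ifs with h
  · rw [← h, D.lie_e_f_same]
  · exact D.lie_e_f_diff i j h

theorem lie_e_c (i : Fin n) (x : 𝔥) : ⁅D.e i, D.c x⁆ = -(R.root i x • D.e i) := by
  rw [← lie_skew, D.lie_c_e]

theorem lie_f_c (i : Fin n) (x : 𝔥) : ⁅D.f i, D.c x⁆ = R.root i x • D.f i := by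
  rw [← lie_skew, D.lie_c_f, neg_neg]

/-- A subspace stable under the generators is stable under `L`. -/
theorem lie_mem_of_stable {S : Submodule ℂ L} (he : ∀ i, ∀ y ∈ S, ⁅D.e i, y⁆ ∈ S)
    (hf : ∀ i, ∀ y ∈ S, ⁅D.f i, y⁆ ∈ S) (hc : ∀ x, ∀ y ∈ S, ⁅D.c x, y⁆ ∈ S) (x : L) :
    ∀ y ∈ S, ⁅x, y⁆ ∈ S := by
  let K : LieSubalgebra ℂ L :=
    { carrier := {x | ∀ y ∈ S, ⁅x, y⁆ ∈ S}
      add_mem' := fun ha hb y hy => by rw [add_lie]; exact S.add_mem (ha y hy) (hb y hy)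
      zero_mem' := fun y _ => by rw [zero_lie]; exact S.zero_mem
      smul_mem' := fun t a ha y hy => by rw [smul_lie]; exact S.smul_mem t (ha y hy)
      lie_mem' := fun {a b} ha hb y hy => by
        rw [lie_lie]; exact S.sub_mem (ha _ (hb y hy)) (hb _ (ha y hy)) }
  have hK : (⊤ : LieSubalgebra ℂ L) ≤ K := by
    rw [← D.lieSpan_eq_top, LieSubalgebra.lieSpan_le]
    rintro _ ((⟨i, rfl⟩ | ⟨i, rfl⟩) | ⟨x, rfl⟩)
    · exact he i
    · exact hf i
    · exact hc x
  exact hK (LieSubalgebra.mem_top x)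

/-- A subspace that contains the generators and is stable under them is the whole of `L`. -/
theorem eq_top_of_stable {S : Submodule ℂ L} (he : ∀ i, ∀ y ∈ S, ⁅D.e i, y⁆ ∈ S)
    (hf : ∀ i, ∀ y ∈ S, ⁅D.f i, y⁆ ∈ S) (hc : ∀ x, ∀ y ∈ S, ⁅D.c x, y⁆ ∈ S)
    (he' : ∀ i, D.e i ∈ S) (hf' : ∀ i, D.f i ∈ S) (hc' : ∀ x, D.c x ∈ S) : S = ⊤ := by
  let K : LieSubalgebra ℂ L :=
    { S with lie_mem' := fun {a b} _ hb => D.lie_mem_of_stable he hf hc a b hb }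
  have hK : (⊤ : LieSubalgebra ℂ L) ≤ K := by
    rw [← D.lieSpan_eq_top, LieSubalgebra.lieSpan_le]
    rintro _ ((⟨i, rfl⟩ | ⟨i, rfl⟩) | ⟨x, rfl⟩)
    · exact he' i
    · exact hf' i
    · exact hc' x
  exact eq_top_iff.mpr fun x _ => hK (LieSubalgebra.mem_top x)

/-! ### Weight spaces -/

/-- The weight space of weight `α` with respect to `𝔥`. -/
def wtSpace (α : Dual ℂ 𝔥) : Submodule ℂ L :=
  ⨅ x : 𝔥, (LieAlgebra.ad ℂ L (D.c x)).eigenspace (α x)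

theorem mem_wtSpace {α : Dual ℂ 𝔥} {y : L} : y ∈ D.wtSpace α ↔ ∀ x, ⁅D.c x, y⁆ = α x • y := by
  simp [wtSpace, Submodule.mem_iInf]

theorem e_mem_wtSpace (i : Fin n) : D.e i ∈ D.wtSpace (R.root i) :=
  D.mem_wtSpace.mpr fun x => D.lie_c_e x i

theorem f_mem_wtSpace (i : Fin n) : D.f i ∈ D.wtSpace (-R.root i) :=
  D.mem_wtSpace.mpr fun x => by simp [D.lie_c_f]

theorem c_mem_wtSpace (x : 𝔥) : D.c x ∈ D.wtSpace 0 :=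
  D.mem_wtSpace.mpr fun y => by simp [D.lie_c_c]

theorem swap_wtSpace (α : Dual ℂ 𝔥) : D.swap.wtSpace α = D.wtSpace (-α) := by
  ext y
  simp only [mem_wtSpace, swap_c, neg_lie, LinearMap.neg_apply, neg_smul, neg_eq_iff_eq_neg]

theorem lie_mem_wtSpace {α β : Dual ℂ 𝔥} {y z : L} (hy : y ∈ D.wtSpace α)
    (hz : z ∈ D.wtSpace β) : ⁅y, z⁆ ∈ D.wtSpace (α + β) := by
  rw [mem_wtSpace] at *
  intro x
  rw [leibniz_lie, hy, hz, smul_lie, lie_smul, LinearMap.add_apply, add_smul]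

/-- The operators `ad (c x)` commute, so their joint generalized eigenspaces are independent, and
weight spaces lie inside these. -/
theorem iSupIndep_wtSpace : iSupIndep D.wtSpace := by
  have hcomm (x y : 𝔥) :
      Commute (LieAlgebra.ad ℂ L (D.c x)) (LieAlgebra.ad ℂ L (D.c y)) := by
    refine LinearMap.ext fun z => ?_
    simp only [Module.End.mul_apply, LieAlgebra.ad_apply]
    rw [leibniz_lie, D.lie_c_c, zero_lie, zero_add]
  have h := Module.End.independent_iInf_maxGenEigenspace_of_forall_mapsTo
    (fun x => LieAlgebra.ad ℂ L (D.c x)) fun x y φ =>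
      Module.End.mapsTo_maxGenEigenspace_of_comm (hcomm y x) φ
  have h2 := h.comp (f := fun α : Dual ℂ 𝔥 => (α : 𝔥 → ℂ)) DFunLike.coe_injective
  refine h2.mono fun α => iInf_mono fun x => ?_
  exact ((LieAlgebra.ad ℂ L (D.c x)).genEigenspace (α x)).mono le_top

/-- The iterated bracket `[e_{l_1}, [e_{l_2}, …, [e_{l_k}, e_i]]]`. -/
def eWord (i : Fin n) : List (Fin n) → L
  | [] => D.e i
  | j :: l => ⁅D.e j, eWord i l⁆

theorem eWord_mem_wtSpace (i : Fin n) (l : List (Fin n)) :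
    D.eWord i l ∈ D.wtSpace (R.wordWeight (i :: l)) := by
  induction l with
  | nil => simpa [eWord] using D.e_mem_wtSpace i
  | cons j l ih =>
    have := D.lie_mem_wtSpace (D.e_mem_wtSpace j) ih
    rw [wordWeight_cons] at this ⊢
    rw [wordWeight_cons, add_left_comm]
    exact this

theorem fWord_mem_wtSpace (i : Fin n) (l : List (Fin n)) :
    D.swap.eWord i l ∈ D.wtSpace (-R.wordWeight (i :: l)) := by
  rw [← swap_wtSpace]
  exact D.swap.eWord_mem_wtSpace i l

/-- The span of `𝔥` and the iterated brackets of the `e_i`. -/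
def borel : Submodule ℂ L :=
  Submodule.span ℂ (Set.range D.c ∪ Set.range fun x : Fin n × List (Fin n) => D.eWord x.1 x.2)

theorem c_mem_borel (x : 𝔥) : D.c x ∈ D.borel := Submodule.subset_span (Or.inl ⟨x, rfl⟩)

theorem eWord_mem_borel (i : Fin n) (l : List (Fin n)) : D.eWord i l ∈ D.borel :=
  Submodule.subset_span (Or.inr ⟨(i, l), rfl⟩)


theorem lie_e_mem_borel (i : Fin n) {y : L} (hy : y ∈ D.borel) : ⁅D.e i, y⁆ ∈ D.borel := by
  induction hy using Submodule.span_induction with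
  | zero => simp
  | add u v _ _ hu hv => rw [lie_add]; exact add_mem hu hv
  | smul t u _ hu => rw [lie_smul]; exact Submodule.smul_mem _ t hu
  | mem u hu =>
    obtain ⟨x, rfl⟩ | ⟨⟨j, l⟩, rfl⟩ := hu
    · rw [D.lie_e_c]
      exact neg_mem (Submodule.smul_mem _ _ (D.eWord_mem_borel i []))
    · exact D.eWord_mem_borel j (i :: l)

theorem lie_c_mem_borel (x : 𝔥) {y : L} (hy : y ∈ D.borel) : ⁅D.c x, y⁆ ∈ D.borel := by
  induction hy using Submodule.span_induction with
  | zero => simp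
  | add u v _ _ hu hv => rw [lie_add]; exact add_mem hu hv
  | smul t u _ hu => rw [lie_smul]; exact Submodule.smul_mem _ t hu
  | mem u hu =>
    obtain ⟨x, rfl⟩ | ⟨⟨j, l⟩, rfl⟩ := hu
    · rw [D.lie_c_c]; exact zero_mem _
    · rw [D.mem_wtSpace.mp (D.eWord_mem_wtSpace j l)]
      exact Submodule.smul_mem _ _ (D.eWord_mem_borel j l)

/-- Moving `f_k` past the leading `e_j` costs only an element of `𝔥`, which acts on the remaining
word by a scalar. -/
theorem lie_f_eWord_mem_borel (k i : Fin n) (l : List (Fin n)) :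
    ⁅D.f k, D.eWord i l⁆ ∈ D.borel := by
  have hfe (j : Fin n) : ⁅D.f k, D.e j⁆ = if j = k then -D.c (R.coroot j) else 0 := by
    rw [← lie_skew, D.lie_e_f]; split_ifs <;> simp
  induction l with
  | nil =>
    rw [eWord, hfe]
    split_ifs
    · exact neg_mem (D.c_mem_borel _)
    · exact zero_mem _
  | cons j l ih =>
    rw [eWord, leibniz_lie, hfe]
    refine add_mem ?_ (D.lie_e_mem_borel j ih)
    split_ifs
    · rw [neg_lie]
      exact neg_mem (D.lie_c_mem_borel _ (D.eWord_mem_borel i l))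
    · rw [zero_lie]; exact zero_mem _

theorem lie_f_mem_sup (k : Fin n) {y : L} (hy : y ∈ D.borel) :
    ⁅D.f k, y⁆ ∈ D.borel ⊔ D.swap.borel := by
  induction hy using Submodule.span_induction with
  | zero => simp
  | add u v _ _ hu hv => rw [lie_add]; exact add_mem hu hv
  | smul t u _ hu => rw [lie_smul]; exact Submodule.smul_mem _ t hu
  | mem u hu =>
    obtain ⟨x, rfl⟩ | ⟨⟨j, l⟩, rfl⟩ := hu
    · rw [D.lie_f_c]
      exact Submodule.mem_sup_right (Submodule.smul_mem _ _ (D.swap.eWord_mem_borel k []))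
    · exact Submodule.mem_sup_left (D.lie_f_eWord_mem_borel k j l)

theorem lie_e_mem_sup (k : Fin n) {y : L} (hy : y ∈ D.borel ⊔ D.swap.borel) :
    ⁅D.e k, y⁆ ∈ D.borel ⊔ D.swap.borel := by
  obtain ⟨u, hu, v, hv, rfl⟩ := Submodule.mem_sup.mp hy
  rw [lie_add]
  refine add_mem (Submodule.mem_sup_left (D.lie_e_mem_borel k hu)) ?_
  have := D.swap.lie_f_mem_sup k hv
  rwa [swap_swap, swap_f, sup_comm] at this

/-- The triangular decomposition, without directness: the sum contains all generators and is stable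
under bracketing with them. -/
theorem borel_sup_swap_borel : D.borel ⊔ D.swap.borel = ⊤ := by
  refine D.eq_top_of_stable (fun i y hy => D.lie_e_mem_sup i hy) (fun i y hy => ?_)
    (fun x y hy => ?_) (fun i => ?_) (fun i => ?_) (fun x => ?_)
  · rw [sup_comm] at hy ⊢
    have := D.swap.lie_e_mem_sup i (y := y)
    rw [swap_swap] at this
    exact this hy
  · obtain ⟨u, hu, v, hv, rfl⟩ := Submodule.mem_sup.mp hy
    rw [lie_add]
    refine add_mem (Submodule.mem_sup_left (D.lie_c_mem_borel x hu))
      (Submodule.mem_sup_right ?_)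
    have := D.swap.lie_c_mem_borel (-x) hv
    rwa [swap_c, map_neg, neg_neg] at this
  · exact Submodule.mem_sup_left (D.eWord_mem_borel i [])
  · exact Submodule.mem_sup_right (D.swap.eWord_mem_borel i [])
  · exact Submodule.mem_sup_left (D.c_mem_borel x)

/-- The iterated brackets of weight `α`, and `𝔥` if `α = 0`. -/
def wordsOfWeight (α : Dual ℂ 𝔥) : Set L :=
  {y | (∃ x, y = D.c x ∧ α = 0) ∨ (∃ i l, y = D.eWord i l ∧ α = R.wordWeight (i :: l)) ∨
    ∃ i l, y = D.swap.eWord i l ∧ α = -R.wordWeight (i :: l)}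

/-- The spans lie in the weight spaces and together fill `L`. Since the weight spaces are
independent, no inclusion can be strict. Every later statement about a single weight space is read
off from this list of words. -/
theorem span_wordsOfWeight (α : Dual ℂ 𝔥) :
    Submodule.span ℂ (D.wordsOfWeight α) = D.wtSpace α := by
  have hle : (fun α => Submodule.span ℂ (D.wordsOfWeight α)) ≤ D.wtSpace := by
    intro α
    rw [Submodule.span_le]
    rintro _ (⟨x, rfl, rfl⟩ | ⟨i, l, rfl, rfl⟩ | ⟨i, l, rfl, rfl⟩)
    · exact D.c_mem_wtSpace x
    · exact D.eWord_mem_wtSpace i l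
    · exact D.fWord_mem_wtSpace i l
  have htop : (⨆ α, Submodule.span ℂ (D.wordsOfWeight α)) = ⊤ := by
    have key {α} {y : L} (hy : y ∈ D.wordsOfWeight α) :
        y ∈ ⨆ α, Submodule.span ℂ (D.wordsOfWeight α) :=
      Submodule.mem_iSup_of_mem α (Submodule.subset_span hy)
    rw [eq_top_iff, ← D.borel_sup_swap_borel, sup_le_iff, borel, borel, Submodule.span_le,
      Submodule.span_le]
    constructor
    · rintro _ (⟨x, rfl⟩ | ⟨⟨i, l⟩, rfl⟩)
      · exact key (Or.inl ⟨x, rfl, rfl⟩)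
      · exact key (Or.inr (Or.inl ⟨i, l, rfl, rfl⟩))
    · rintro _ (⟨x, rfl⟩ | ⟨⟨i, l⟩, rfl⟩)
      · exact key (Or.inl ⟨-x, by simp, rfl⟩)
      · exact key (Or.inr (Or.inr ⟨i, l, rfl, rfl⟩))
  exact congrFun ((D.iSupIndep_wtSpace.le_iff_eq_of_iSup_eq_top htop).mp hle) α

theorem iSup_wtSpace : (⨆ α, D.wtSpace α) = ⊤ := by
  rw [eq_top_iff, ← D.borel_sup_swap_borel, sup_le_iff, borel, borel, Submodule.span_le,
      Submodule.span_le]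
  constructor
  · rintro _ (⟨x, rfl⟩ | ⟨⟨i, l⟩, rfl⟩)
    · exact Submodule.mem_iSup_of_mem _ (D.c_mem_wtSpace x)
    · exact Submodule.mem_iSup_of_mem _ (D.eWord_mem_wtSpace i l)
  · rintro _ (⟨x, rfl⟩ | ⟨⟨i, l⟩, rfl⟩)
    · exact Submodule.mem_iSup_of_mem _ (neg_mem (D.c_mem_wtSpace x))
    · exact Submodule.mem_iSup_of_mem _ (D.fWord_mem_wtSpace i l)

end Chevalley

/-! ### Signs of weights and multiples of a simple root. -/

theorem wordWeight_cons_ne_zero (R : A.Realization 𝔥) (i : Fin n) (l : List (Fin n)) :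
    R.wordWeight (i :: l) ≠ 0 := by
  intro h
  rw [wordWeight_eq_sum] at h
  have := Fintype.linearIndependent_iff.mp R.linearIndependent_root _ h i
  simp at this
  norm_cast at this

theorem wordWeight_eq_nsmul_root (R : A.Realization 𝔥) {i : Fin n} {l : List (Fin n)} {k : ℕ}
    (h : R.wordWeight l = k • R.root i) : l = List.replicate k i := by
  rw [wordWeight_eq_sum] at h
  have h1 : ∑ j, (if j = i then (k : ℂ) else 0) • R.root j = k • R.root i := by
    simp [ite_smul, Nat.cast_smul_eq_nsmul]
  rw [← h1, wt_eq_wt_iff] at h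
  have hmem : ∀ j ∈ l, j = i := by
    intro j hj
    by_contra hne
    have := congrFun h j
    rw [if_neg hne, Nat.cast_eq_zero, List.count_eq_zero] at this
    exact this hj
  have hl := List.eq_replicate_of_mem hmem
  have hk := congrFun h i
  rw [if_pos rfl, Nat.cast_inj, hl, List.count_replicate_self] at hk
  rw [hl, hk]

theorem wordWeight_ne_neg (R : A.Realization 𝔥) (i j : Fin n) (l m : List (Fin n)) :
    R.wordWeight (i :: l) ≠ -R.wordWeight (j :: m) := by
  intro h
  have := R.wordWeight_cons_ne_zero i (l ++ j :: m)
  apply this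
  have h2 : R.wordWeight (i :: (l ++ j :: m)) = R.wordWeight (i :: l) + R.wordWeight (j :: m) := by
    simp [wordWeight, add_assoc]
  rw [h2, h, neg_add_cancel]

end GCM.Realization

namespace GCM.Realization

variable {n : ℕ} {A : GCM n} {𝔥 : Type*} [AddCommGroup 𝔥] [Module ℂ 𝔥]

namespace Chevalley

variable {R : A.Realization 𝔥} {L : Type*} [LieRing L] [LieAlgebra ℂ L] (D : Chevalley R L)

/-- The innermost bracket is `[e_i, e_i]`. -/
theorem eWord_replicate (i : Fin n) (k : ℕ) : D.eWord i (List.replicate (k + 1) i) = 0 := by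
  induction k with
  | zero => simp [eWord]
  | succ k ih => rw [List.replicate_succ, eWord, ih, lie_zero]

theorem wtSpace_zero : D.wtSpace 0 = LinearMap.range D.c := by
  rw [← span_wordsOfWeight]
  refine le_antisymm (Submodule.span_le.mpr ?_) ?_
  · rintro _ (⟨x, rfl, -⟩ | ⟨i, l, rfl, h⟩ | ⟨i, l, rfl, h⟩)
    · exact ⟨x, rfl⟩
    · exact absurd h.symm (R.wordWeight_cons_ne_zero i l)
    · exact absurd (neg_eq_zero.mp h.symm) (R.wordWeight_cons_ne_zero i l)
  · rintro _ ⟨x, rfl⟩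
    exact Submodule.subset_span (Or.inl ⟨x, rfl, rfl⟩)

theorem mem_span_of_mem_wtSpace_nsmul_root {i : Fin n} {k : ℕ} {y : L}
    (hy : y ∈ D.wtSpace ((k + 1) • R.root i)) :
    y ∈ Submodule.span ℂ {D.eWord i (List.replicate k i)} := by
  rw [← span_wordsOfWeight] at hy
  refine Submodule.span_mono ?_ hy
  have hk : (k + 1) • R.root i = R.wordWeight (i :: List.replicate k i) := by
    rw [← List.replicate_succ]; simp [wordWeight]
  rintro _ (⟨x, rfl, h⟩ | ⟨j, l, rfl, h⟩ | ⟨j, l, rfl, h⟩)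
  · rw [hk] at h
    exact absurd h (R.wordWeight_cons_ne_zero i _)
  · have := R.wordWeight_eq_nsmul_root h.symm
    rw [List.replicate_succ, List.cons.injEq] at this
    rw [this.1, this.2]
    rfl
  · rw [hk] at h
    exact absurd h (R.wordWeight_ne_neg _ _ _ _)

theorem wtSpace_root (i : Fin n) : D.wtSpace (R.root i) = Submodule.span ℂ {D.e i} := by
  refine le_antisymm (fun y hy => ?_) ?_
  · exact D.mem_span_of_mem_wtSpace_nsmul_root (k := 0) (by simpa using hy)
  · rw [Submodule.span_singleton_le_iff_mem]
    exact D.e_mem_wtSpace i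

theorem wtSpace_nsmul_root (i : Fin n) (k : ℕ) : D.wtSpace ((k + 2) • R.root i) = ⊥ := by
  refine eq_bot_iff.mpr fun y hy => ?_
  have := D.mem_span_of_mem_wtSpace_nsmul_root (k := k + 1) hy
  rwa [eWord_replicate, Submodule.span_zero_singleton] at this

theorem mem_posCone_or_of_wtSpace_ne_bot {α : Dual ℂ 𝔥} (h : D.wtSpace α ≠ ⊥) (h0 : α ≠ 0) :
    α ∈ R.posCone ∨ -α ∈ R.posCone := by
  rw [← span_wordsOfWeight, Ne, Submodule.span_eq_bot] at h
  push Not at h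
  obtain ⟨y, ⟨x, -, h⟩ | ⟨i, l, -, rfl⟩ | ⟨i, l, -, rfl⟩, -⟩ := h
  · exact absurd h h0
  · exact Or.inl (R.wordWeight_mem_posCone _)
  · rw [neg_neg]
    exact Or.inr (R.wordWeight_mem_posCone _)

/-! ### Quotients, ideals and their weight components. -/

/-- The image of Chevalley generators under a surjective homomorphism. -/
def map {L' : Type*} [LieRing L'] [LieAlgebra ℂ L'] (φ : L →ₗ⁅ℂ⁆ L')
    (hφ : Function.Surjective φ) : Chevalley R L' where
  e i := φ (D.e i)
  f i := φ (D.f i)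
  c := (φ : L →ₗ[ℂ] L') ∘ₗ D.c
  lie_c_c x y := by
    simp only [LinearMap.comp_apply, LieHom.coe_toLinearMap, ← LieHom.map_lie, D.lie_c_c, map_zero]
  lie_c_e x i := by
    simp only [LinearMap.comp_apply, LieHom.coe_toLinearMap, ← LieHom.map_lie, D.lie_c_e, map_smul]
  lie_c_f x i := by
    simp only [LinearMap.comp_apply, LieHom.coe_toLinearMap, ← LieHom.map_lie, D.lie_c_f, map_smul,
      map_neg]
  lie_e_f_same i := by
    simp only [LinearMap.comp_apply, LieHom.coe_toLinearMap, ← LieHom.map_lie, D.lie_e_f_same]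
  lie_e_f_diff i j h := by
    simp only [← LieHom.map_lie, D.lie_e_f_diff i j h, map_zero]
  lieSpan_eq_top := by
    rw [eq_top_iff]
    rintro z -
    obtain ⟨y, rfl⟩ := hφ z
    have hK : (⊤ : LieSubalgebra ℂ L) ≤ LieSubalgebra.comap φ (LieSubalgebra.lieSpan ℂ L'
        (Set.range (fun i => φ (D.e i)) ∪ Set.range (fun i => φ (D.f i)) ∪
          Set.range ((φ : L →ₗ[ℂ] L') ∘ₗ D.c))) := by
      rw [← D.lieSpan_eq_top, LieSubalgebra.lieSpan_le]
      rintro _ ((⟨i, rfl⟩ | ⟨i, rfl⟩) | ⟨x, rfl⟩)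
      · exact LieSubalgebra.subset_lieSpan (Or.inl (Or.inl ⟨i, rfl⟩))
      · exact LieSubalgebra.subset_lieSpan (Or.inl (Or.inr ⟨i, rfl⟩))
      · exact LieSubalgebra.subset_lieSpan (Or.inr ⟨x, rfl⟩)
    exact hK (LieSubalgebra.mem_top y)

theorem map_mem_wtSpace {L' : Type*} [LieRing L'] [LieAlgebra ℂ L'] (φ : L →ₗ⁅ℂ⁆ L')
    (hφ : Function.Surjective φ) {α : Dual ℂ 𝔥} {y : L} (hy : y ∈ D.wtSpace α) :
    φ y ∈ (D.map φ hφ).wtSpace α := by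
  rw [mem_wtSpace] at *
  intro x
  rw [map, LinearMap.comp_apply, LieHom.coe_toLinearMap, ← LieHom.map_lie, hy, map_smul]

/-- The quotient of a Lie algebra by an ideal, as a homomorphism. -/
def _root_.LieIdeal.quotientHom {L : Type*} [LieRing L] [LieAlgebra ℂ L] (I : LieIdeal ℂ L) :
    L →ₗ⁅ℂ⁆ L ⧸ I :=
  { (LieSubmodule.Quotient.mk' I : L →ₗ[ℂ] L ⧸ I) with
    map_lie' := fun {x y} => LieSubmodule.Quotient.mk_bracket _ x y }

theorem _root_.LieIdeal.quotientHom_surjective {L : Type*} [LieRing L] [LieAlgebra ℂ L]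
    (I : LieIdeal ℂ L) : Function.Surjective I.quotientHom :=
  LieSubmodule.Quotient.surjective_mk' I

theorem _root_.LieIdeal.quotientHom_eq_zero {L : Type*} [LieRing L] [LieAlgebra ℂ L]
    (I : LieIdeal ℂ L) {x : L} : I.quotientHom x = 0 ↔ x ∈ I :=
  LieSubmodule.Quotient.mk_eq_zero I

/-- Ideals are sums of their weight spaces. -/
theorem le_iSup_inf_wtSpace (I : LieIdeal ℂ L) :
    I.toSubmodule ≤ ⨆ α, I.toSubmodule ⊓ D.wtSpace α := by
  intro y hy
  obtain ⟨s, hs⟩ := (Submodule.mem_iSup_iff_exists_finsupp D.wtSpace y).mp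
    (D.iSup_wtSpace ▸ Submodule.mem_top)
  obtain ⟨hs, hsum⟩ := hs
  -- The weight components of `y` sum to zero in `L ⧸ I`; independence of weight spaces there puts
  -- each of them in `I`.
  have hind := (D.map I.quotientHom I.quotientHom_surjective).iSupIndep_wtSpace
  rw [iSupIndep_iff_finsetSum_eq_zero_imp_eq_zero] at hind
  have h0 := hind s.support (fun α => I.quotientHom (s α))
    (fun α _ => D.map_mem_wtSpace _ _ (hs α)) (by
      rw [← map_sum, I.quotientHom_eq_zero]
      change (s.sum fun _ v => v) ∈ I
      rw [hsum]
      exact hy)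
  rw [← hsum]
  refine Submodule.sum_mem _ fun α hα => Submodule.mem_iSup_of_mem α ⟨?_, hs α⟩
  exact I.quotientHom_eq_zero.mp (h0 α hα)

/-- A sum of ideals that meet `𝔥` trivially meets `𝔥` trivially. -/
theorem c_eq_zero_of_mem_sSup {S : Set (LieIdeal ℂ L)}
    (hS : ∀ I ∈ S, ∀ x, D.c x ∈ I → D.c x = 0) {x : 𝔥} (hx : D.c x ∈ sSup S) : D.c x = 0 := by
  -- The part of the sum of ideals in weight `α`. It vanishes for `α = 0`, because the zero weight
  -- space is exactly the image of `𝔥`.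
  set K : Dual ℂ 𝔥 → Submodule ℂ L := fun α => ⨆ I : S, (I : LieIdeal ℂ L).toSubmodule ⊓ D.wtSpace α
  have hK (α) : K α ≤ D.wtSpace α := iSup_le fun I => inf_le_right
  have hK0 : K 0 = ⊥ := by
    refine eq_bot_iff.mpr (iSup_le fun I => ?_)
    rintro y ⟨hyI, hy⟩
    rw [wtSpace_zero] at hy
    obtain ⟨z, rfl⟩ := hy
    exact hS I I.2 z hyI
  have hle : (sSup S).toSubmodule ≤ ⨆ α, K α := by
    rw [LieSubmodule.sSup_toSubmodule]
    refine sSup_le ?_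
    rintro _ ⟨I, hI, rfl⟩
    refine (D.le_iSup_inf_wtSpace I).trans (iSup_mono fun α => ?_)
    exact le_iSup (fun I : S => (I : LieIdeal ℂ L).toSubmodule ⊓ D.wtSpace α) ⟨I, hI⟩
  have hle2 : (⨆ α, K α) ≤ ⨆ (α) (_ : α ≠ 0), D.wtSpace α := by
    refine iSup_le fun α => ?_
    by_cases h : α = 0
    · rw [h, hK0]; exact bot_le
    · exact (hK α).trans (le_iSup₂ (f := fun α (_ : α ≠ 0) => D.wtSpace α) α h)
  exact Submodule.disjoint_def.mp (D.iSupIndep_wtSpace 0) _ (D.c_mem_wtSpace x)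
    (hle2 (hle hx))

end Chevalley
end GCM.Realization

namespace GCM.Realization

variable {n : ℕ} {A : GCM n} {𝔥 : Type*} [AddCommGroup 𝔥] [Module ℂ 𝔥] (R : A.Realization 𝔥)

/-! ### The auxiliary Lie algebra and a Verma module -/

/-- The underlying space of the Verma module: the free vector space on words. -/
abbrev Verma (n : ℕ) : Type := List (Fin n) →₀ ℂ

/-- `f_i` acts on the Verma module by left multiplication. -/
def vermaF (i : Fin n) : Module.End ℂ (Verma n) :=
  Finsupp.lmapDomain ℂ ℂ (List.cons i)

/-- `x ∈ 𝔥` acts on the Verma module of highest weight `Λ` diagonally. -/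
def vermaH (Λ : Dual ℂ 𝔥) (x : 𝔥) : Module.End ℂ (Verma n) :=
  Finsupp.lsum ℂ fun l => (Λ - R.wordWeight l) x • Finsupp.lsingle l

/-- The action of `e_i` on the words. -/
def vermaEWord (Λ : Dual ℂ 𝔥) (i : Fin n) : List (Fin n) → Verma n
  | [] => 0
  | j :: l => (if i = j then (Λ - R.wordWeight l) (R.coroot i) • Finsupp.single l 1 else 0) +
      vermaF j (vermaEWord Λ i l)

/-- The action of `e_i` on the Verma module of highest weight `Λ`. -/
def vermaE (Λ : Dual ℂ 𝔥) (i : Fin n) : Module.End ℂ (Verma n) :=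
  Finsupp.lsum ℂ fun l => LinearMap.toSpanSingleton ℂ _ (R.vermaEWord Λ i l)

@[simp] theorem vermaF_single (i : Fin n) (l : List (Fin n)) :
    vermaF i (Finsupp.single l 1) = Finsupp.single (i :: l) 1 := by
  simp [vermaF]

@[simp] theorem vermaH_single (Λ : Dual ℂ 𝔥) (x : 𝔥) (l : List (Fin n)) :
    R.vermaH Λ x (Finsupp.single l 1) = (Λ - R.wordWeight l) x • Finsupp.single l 1 := by
  simp [vermaH]

@[simp] theorem vermaE_single (Λ : Dual ℂ 𝔥) (i : Fin n) (l : List (Fin n)) :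
    R.vermaE Λ i (Finsupp.single l 1) = R.vermaEWord Λ i l := by
  simp [vermaE]

theorem verma_ext {V : Type*} [AddCommGroup V] [Module ℂ V] {φ ψ : Verma n →ₗ[ℂ] V}
    (h : ∀ l, φ (Finsupp.single l 1) = ψ (Finsupp.single l 1)) : φ = ψ :=
  Finsupp.lhom_ext' fun l => LinearMap.ext_ring (h l)

theorem vermaH_vermaF (Λ : Dual ℂ 𝔥) (x : 𝔥) (i : Fin n) (v : Verma n) :
    R.vermaH Λ x (vermaF i v) = vermaF i (R.vermaH Λ x v) - R.root i x • vermaF i v := by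
  suffices h : R.vermaH Λ x ∘ₗ vermaF i = vermaF i ∘ₗ R.vermaH Λ x - R.root i x • vermaF i from
    LinearMap.congr_fun h v
  refine verma_ext fun l => ?_
  simp only [LinearMap.comp_apply, LinearMap.sub_apply, LinearMap.smul_apply, vermaF_single,
    vermaH_single, map_smul, ← sub_smul, wordWeight_cons, LinearMap.add_apply]
  congr 1
  ring

theorem vermaE_vermaF (Λ : Dual ℂ 𝔥) (i j : Fin n) (v : Verma n) :
    R.vermaE Λ i (vermaF j v) = (if i = j then R.vermaH Λ (R.coroot i) v else 0) +
      vermaF j (R.vermaE Λ i v) := by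
  suffices h : R.vermaE Λ i ∘ₗ vermaF j =
      (if i = j then R.vermaH Λ (R.coroot i) else 0) + vermaF j ∘ₗ R.vermaE Λ i by
    have := LinearMap.congr_fun h v
    split_ifs at this ⊢ <;> simpa using this
  refine verma_ext fun l => ?_
  split_ifs with h <;> simp [vermaEWord, h]

theorem vermaH_vermaE (Λ : Dual ℂ 𝔥) (x : 𝔥) (i : Fin n) (v : Verma n) :
    R.vermaH Λ x (R.vermaE Λ i v) = R.vermaE Λ i (R.vermaH Λ x v) + R.root i x • R.vermaE Λ i v := by
  suffices h : R.vermaH Λ x ∘ₗ R.vermaE Λ i =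
      R.vermaE Λ i ∘ₗ R.vermaH Λ x + R.root i x • R.vermaE Λ i from LinearMap.congr_fun h v
  refine verma_ext fun l => ?_
  simp only [LinearMap.comp_apply, LinearMap.add_apply, LinearMap.smul_apply, vermaE_single,
    vermaH_single, map_smul]
  induction l with
  | nil => simp [vermaEWord]
  | cons j l ih =>
    rw [vermaEWord, map_add, vermaH_vermaF, ih]
    split_ifs with h
    · subst h
      simp only [map_smul, vermaH_single, wordWeight_cons, map_add, smul_add, LinearMap.sub_apply,
        LinearMap.add_apply]
      module
    · simp only [map_smul, wordWeight_cons, map_add, map_zero, smul_add, LinearMap.sub_apply,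
        LinearMap.add_apply]
      module

theorem vermaH_add (Λ : Dual ℂ 𝔥) (x y : 𝔥) :
    R.vermaH Λ (x + y) = R.vermaH Λ x + R.vermaH Λ y :=
  verma_ext fun l => by simp only [vermaH_single, LinearMap.add_apply, map_add, add_smul]

theorem vermaH_smul (Λ : Dual ℂ 𝔥) (t : ℂ) (x : 𝔥) :
    R.vermaH Λ (t • x) = t • R.vermaH Λ x :=
  verma_ext fun l => by simp only [vermaH_single, LinearMap.smul_apply, map_smul, smul_assoc]

attribute [local instance] LieRing.ofAssociativeRing

/-- The action of the generators on the Verma module. -/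
def vermaGen (Λ : Dual ℂ 𝔥) : KMGenerator n 𝔥 → Module.End ℂ (Verma n)
  | .e i => R.vermaE Λ i
  | .f i => vermaF i
  | .h x => R.vermaH Λ x

/-- The action of the free Lie algebra on the Verma module. -/
def vermaHom (Λ : Dual ℂ 𝔥) :
    FreeLieAlgebra ℂ (KMGenerator n 𝔥) →ₗ⁅ℂ⁆ Module.End ℂ (Verma n) :=
  FreeLieAlgebra.lift ℂ (R.vermaGen Λ)

/-- This makes the space of words a module over `𝔤̃(A)`, for every highest weight `Λ`. -/
theorem relIdeal_le_ker (Λ : Dual ℂ 𝔥) : R.relIdeal ≤ (R.vermaHom Λ).ker := by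
  have hE (i) : R.vermaHom Λ (genE n 𝔥 i) = R.vermaE Λ i := FreeLieAlgebra.lift_of_apply _ _
  have hF (i) : R.vermaHom Λ (genF n 𝔥 i) = vermaF i := FreeLieAlgebra.lift_of_apply _ _
  have hH (x) : R.vermaHom Λ (genH n x) = R.vermaH Λ x := FreeLieAlgebra.lift_of_apply _ _
  rw [relIdeal, LieSubmodule.lieSpan_le]
  intro z hz
  rw [SetLike.mem_coe, LieHom.mem_ker]
  cases hz with
  | h_add x y => simp only [map_sub, hH, vermaH_add]; abel
  | h_smul t x => simp only [map_sub, map_smul, hH, vermaH_smul, sub_self]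
  | hh x y =>
    rw [LieHom.map_lie, hH, hH, LieRing.of_associative_ring_bracket]
    refine verma_ext fun l => ?_
    simp only [LinearMap.sub_apply, Module.End.mul_apply, vermaH_single, map_smul,
      LinearMap.zero_apply]
    rw [smul_comm, sub_self]
  | ef_same i =>
    rw [map_sub, LieHom.map_lie, hE, hF, hH, LieRing.of_associative_ring_bracket]
    refine LinearMap.ext fun v => ?_
    simp [vermaE_vermaF]
  | ef_diff i j hij =>
    rw [LieHom.map_lie, hE, hF, LieRing.of_associative_ring_bracket]
    refine LinearMap.ext fun v => ?_
    simp [vermaE_vermaF, hij]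
  | he x i =>
    rw [map_sub, map_smul, LieHom.map_lie, hE, hH, LieRing.of_associative_ring_bracket]
    refine LinearMap.ext fun v => ?_
    simp [vermaH_vermaE]
  | hf x i =>
    rw [map_add, map_smul, LieHom.map_lie, hF, hH, LieRing.of_associative_ring_bracket]
    refine LinearMap.ext fun v => ?_
    simp [vermaH_vermaF]

/-- On the highest weight vector `x` acts by `Λ(x)`, and `Λ` is arbitrary. -/
theorem auxCartan_eq_zero {x : 𝔥} (h : R.auxCartan x = 0) : x = 0 := by
  rw [← Module.forall_dual_apply_eq_zero_iff ℂ]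
  intro Λ
  have h1 : genH n x ∈ R.relIdeal := (LieSubmodule.Quotient.mk_eq_zero R.relIdeal).mp h
  have h2 : R.vermaHom Λ (genH n x) = 0 := LieHom.mem_ker.mp (R.relIdeal_le_ker Λ h1)
  have h3 : R.vermaHom Λ (genH n x) = R.vermaH Λ x := FreeLieAlgebra.lift_of_apply _ _
  rw [h3] at h2
  have h4 := congrArg (fun v : Verma n => v []) (LinearMap.congr_fun h2 (Finsupp.single [] 1))
  simpa using h4

/-- By the universal property, the identity factors through the subalgebra spanned by the
generators. -/
theorem freeLieAlgebra_lieSpan_of (X : Type*) :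
    LieSubalgebra.lieSpan ℂ (FreeLieAlgebra ℂ X) (Set.range (FreeLieAlgebra.of ℂ)) = ⊤ := by
  set K := LieSubalgebra.lieSpan ℂ (FreeLieAlgebra ℂ X) (Set.range (FreeLieAlgebra.of ℂ))
  let φ : FreeLieAlgebra ℂ X →ₗ⁅ℂ⁆ K := FreeLieAlgebra.lift ℂ fun x =>
    ⟨FreeLieAlgebra.of ℂ x, LieSubalgebra.subset_lieSpan ⟨x, rfl⟩⟩
  have h : K.incl.comp φ = LieHom.id := by
    ext x
    simp [φ]
  rw [eq_top_iff]
  intro y _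
  have := LieHom.congr_fun h y
  rw [LieHom.comp_apply, LieHom.id_apply] at this
  rw [← this]
  exact (φ y).2

theorem auxCartan_add (x y : 𝔥) : R.auxCartan (x + y) = R.auxCartan x + R.auxCartan y := by
  have h := (R.relIdeal.quotientHom_eq_zero).mpr
    (LieSubmodule.subset_lieSpan (R := ℂ) (Rel.h_add (R := R) x y))
  rwa [map_sub, map_sub, sub_sub, sub_eq_zero] at h

theorem auxCartan_smul (t : ℂ) (x : 𝔥) : R.auxCartan (t • x) = t • R.auxCartan x := by
  have h := (R.relIdeal.quotientHom_eq_zero).mpr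
    (LieSubmodule.subset_lieSpan (R := ℂ) (Rel.h_smul (R := R) t x))
  rwa [map_sub, map_smul, sub_eq_zero] at h

/-- The Chevalley generators of `𝔤̃(A)`. -/
def auxChevalley : Chevalley R R.Aux where
  e i := R.relIdeal.quotientHom (genE n 𝔥 i)
  f i := R.relIdeal.quotientHom (genF n 𝔥 i)
  c := { toFun := R.auxCartan, map_add' := R.auxCartan_add, map_smul' := R.auxCartan_smul }
  lie_c_c x y := (R.relIdeal.quotientHom_eq_zero).mpr
    (LieSubmodule.subset_lieSpan (R := ℂ) (Rel.hh (R := R) x y))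
  lie_c_e x i := by
    have h := (R.relIdeal.quotientHom_eq_zero).mpr
      (LieSubmodule.subset_lieSpan (R := ℂ) (Rel.he (R := R) x i))
    rwa [map_sub, map_smul, sub_eq_zero] at h
  lie_c_f x i := by
    have h := (R.relIdeal.quotientHom_eq_zero).mpr
      (LieSubmodule.subset_lieSpan (R := ℂ) (Rel.hf (R := R) x i))
    rwa [map_add, map_smul, add_eq_zero_iff_eq_neg] at h
  lie_e_f_same i := by
    have h := (R.relIdeal.quotientHom_eq_zero).mpr
      (LieSubmodule.subset_lieSpan (R := ℂ) (Rel.ef_same (R := R) i))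
    rwa [map_sub, sub_eq_zero] at h
  lie_e_f_diff i j hij := (R.relIdeal.quotientHom_eq_zero).mpr
    (LieSubmodule.subset_lieSpan (R := ℂ) (Rel.ef_diff (R := R) i j hij))
  lieSpan_eq_top := by
    rw [eq_top_iff]
    rintro z -
    obtain ⟨y, rfl⟩ := R.relIdeal.quotientHom_surjective z
    revert y
    suffices hK : (⊤ : LieSubalgebra ℂ (FreeLieAlgebra ℂ (KMGenerator n 𝔥))) ≤
        LieSubalgebra.comap R.relIdeal.quotientHom (LieSubalgebra.lieSpan ℂ R.Aux _) from
      fun y => hK (LieSubalgebra.mem_top y)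
    rw [← freeLieAlgebra_lieSpan_of, LieSubalgebra.lieSpan_le]
    rintro _ ⟨i | i | x, rfl⟩
    · exact LieSubalgebra.subset_lieSpan (Or.inl (Or.inl ⟨i, rfl⟩))
    · exact LieSubalgebra.subset_lieSpan (Or.inl (Or.inr ⟨i, rfl⟩))
    · exact LieSubalgebra.subset_lieSpan (Or.inr ⟨x, rfl⟩)

/-- The Chevalley generators of `𝔤(A)`. -/
def chevalley : Chevalley R R.KacMoody :=
  R.auxChevalley.map R.maxIdeal.quotientHom R.maxIdeal.quotientHom_surjective

theorem wtSpace_chevalley (α : Dual ℂ 𝔥) : R.chevalley.wtSpace α = R.rootSpace α := rfl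

theorem chevalley_c_injective : Function.Injective R.chevalley.c := by
  rw [injective_iff_map_eq_zero]
  intro x hx
  apply R.auxCartan_eq_zero
  refine R.auxChevalley.c_eq_zero_of_mem_sSup (S := {I : LieIdeal ℂ R.Aux |
    ∀ x : 𝔥, R.auxCartan x ∈ I → R.auxCartan x = 0}) (fun I hI => hI) ?_
  exact R.maxIdeal.quotientHom_eq_zero.mp hx

/-- An ideal of `𝔤(A)` that intersects `𝔥` trivially is zero. -/
theorem eq_bot_of_cartan_trivial (I : LieIdeal ℂ R.KacMoody)
    (hI : ∀ x, R.chevalley.c x ∈ I → x = 0) : I = ⊥ := by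
  -- The preimage of `I` in `𝔤̃(A)` also meets `𝔥` trivially, so maximality absorbs it.
  have hle : I.comap R.maxIdeal.quotientHom ≤ R.maxIdeal := by
    refine le_sSup fun x hx => ?_
    rw [hI x (LieIdeal.mem_comap.mp hx)]
    exact map_zero R.auxChevalley.c
  refine eq_bot_iff.mpr fun z hz => ?_
  obtain ⟨y, rfl⟩ := R.maxIdeal.quotientHom_surjective z
  exact R.maxIdeal.quotientHom_eq_zero.mpr (hle (LieIdeal.mem_comap.mpr hz))

end GCM.Realization

namespace GCM.Realization

variable {n : ℕ} {A : GCM n} {𝔥 : Type*} [AddCommGroup 𝔥] [Module ℂ 𝔥]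

namespace Chevalley

variable {R : A.Realization 𝔥} {L : Type*} [LieRing L] [LieAlgebra ℂ L] (D : Chevalley R L)

/-! ### Serre relations and local nilpotency -/

/-- `𝔥` embeds into `L`, and no nonzero ideal of `L` meets `𝔥` trivially. -/
structure IsReduced : Prop where
  c_injective : Function.Injective D.c
  eq_bot : ∀ I : LieIdeal ℂ L, (∀ x, D.c x ∈ I → x = 0) → I = ⊥

variable {D}

theorem IsReduced.swap (hD : D.IsReduced) : D.swap.IsReduced where
  c_injective x y h := hD.c_injective (neg_injective h)
  eq_bot I hI := hD.eq_bot I fun x hx => by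
    have := hI (-x) (by rwa [swap_c, map_neg, neg_neg])
    rwa [neg_eq_zero] at this

variable (D)

/-- The elements `[f_{l_1}, [f_{l_2}, …, [f_{l_k}, y]]]`. -/
def fAct (y : L) : List (Fin n) → L
  | [] => y
  | j :: l => ⁅D.f j, fAct y l⁆

theorem fAct_mem_wtSpace {y : L} {i : Fin n} {l : List (Fin n)}
    (hy : y ∈ D.wtSpace (-R.wordWeight (i :: l))) (m : List (Fin n)) :
    D.fAct y m ∈ D.wtSpace (-R.wordWeight (i :: (m ++ l))) := by
  induction m with
  | nil => exact hy
  | cons j m ih =>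
    have := D.lie_mem_wtSpace (D.f_mem_wtSpace j) ih
    rw [← neg_add] at this
    simp only [List.cons_append, wordWeight_cons] at this ⊢
    rwa [add_left_comm] at this

variable {D}

/-- A vector of negative weight that is annihilated by all `e_k` vanishes. -/
theorem IsReduced.eq_zero_of_lie_e_eq_zero (hD : D.IsReduced) {y : L} {i : Fin n}
    {l : List (Fin n)} (hy : y ∈ D.wtSpace (-R.wordWeight (i :: l)))
    (he : ∀ k, ⁅D.e k, y⁆ = 0) : y = 0 := by
  -- Since the `e_k` kill `y`, lowering `y` by the `f_j` already spans an ideal. All its weights are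
  -- negative, so it meets `𝔥` trivially.
  set P : Submodule ℂ L := Submodule.span ℂ (Set.range (D.fAct y))
  have hmem (m) : D.fAct y m ∈ P := Submodule.subset_span ⟨m, rfl⟩
  have hstable (z : L) (hz : ∀ m, ⁅z, D.fAct y m⁆ ∈ P) : ∀ u ∈ P, ⁅z, u⁆ ∈ P := by
    intro u hu
    induction hu using Submodule.span_induction with
    | zero => simp
    | add u v _ _ hu hv => rw [lie_add]; exact add_mem hu hv
    | smul t u _ hu => rw [lie_smul]; exact Submodule.smul_mem _ t hu
    | mem u hu => obtain ⟨m, rfl⟩ := hu; exact hz m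
  have hc (x) : ∀ u ∈ P, ⁅D.c x, u⁆ ∈ P := hstable _ fun m => by
    rw [D.mem_wtSpace.mp (D.fAct_mem_wtSpace hy m)]
    exact Submodule.smul_mem _ _ (hmem m)
  have hf (k) : ∀ u ∈ P, ⁅D.f k, u⁆ ∈ P := hstable _ fun m => hmem (k :: m)
  have he' (k) : ∀ u ∈ P, ⁅D.e k, u⁆ ∈ P := hstable _ fun m => by
    induction m with
    | nil => rw [fAct, he]; exact zero_mem _
    | cons j m ih =>
      rw [fAct, leibniz_lie, D.lie_e_f]
      refine add_mem ?_ (hf j _ ih)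
      split_ifs
      · exact hc _ _ (hmem m)
      · rw [zero_lie]; exact zero_mem _
  let I : LieIdeal ℂ L := { P with lie_mem := fun {x m} hm => D.lie_mem_of_stable he' hf hc x m hm }
  have hI : I = ⊥ := by
    refine hD.eq_bot I fun x (hx : D.c x ∈ P) => ?_
    have hle : P ≤ ⨆ (α) (_ : α ≠ 0), D.wtSpace α := by
      rw [Submodule.span_le]
      rintro _ ⟨m, rfl⟩
      exact (le_iSup₂ (f := fun α (_ : α ≠ 0) => D.wtSpace α) _
        (neg_ne_zero.mpr (R.wordWeight_cons_ne_zero _ _))) (D.fAct_mem_wtSpace hy m)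
    have := Submodule.disjoint_def.mp (D.iSupIndep_wtSpace 0) _ (D.c_mem_wtSpace x) (hle hx)
    exact hD.c_injective (by rw [this, map_zero])
  have h : y ∈ I := hmem []
  rw [hI] at h
  exact h

variable (D)

theorem ad_pow_e_eq_eWord (i j : Fin n) (m : ℕ) :
    (LieAlgebra.ad ℂ L (D.e i) ^ m) (D.e j) = D.eWord j (List.replicate m i) := by
  induction m with
  | zero => rfl
  | succ m ih => rw [pow_succ', Module.End.mul_apply, ih]; rfl

theorem lie_e_fWord_of_ne {i j k : Fin n} (hki : k ≠ i) (hkj : k ≠ j) (m : ℕ) :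
    ⁅D.e k, D.swap.eWord j (List.replicate m i)⁆ = 0 := by
  induction m with
  | zero => exact D.lie_e_f_diff k j hkj
  | succ m ih =>
    rw [List.replicate_succ, eWord, leibniz_lie, ih, swap_e, D.lie_e_f_diff k i hki, zero_lie,
      lie_zero, zero_add]

/-- `e_j` only interacts with the innermost `f_j`, leaving `(ad f_i)^{m+1}` applied to `α_j^∨`; this
is a multiple of `f_i` for `m = 0` and is then killed by `ad f_i`. -/
theorem lie_e_fWord_right {i j : Fin n} (hij : i ≠ j) (m : ℕ) :
    ⁅D.e j, D.swap.eWord j (List.replicate (m + 1) i)⁆ =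
      if m = 0 then R.root i (R.coroot j) • D.f i else 0 := by
  induction m with
  | zero =>
    rw [List.replicate_succ, eWord, leibniz_lie, swap_e, D.lie_e_f_diff j i hij.symm, zero_lie,
      zero_add, List.replicate_zero, eWord, swap_e, D.lie_e_f_same, D.lie_f_c, if_pos rfl]
  | succ m ih =>
    rw [List.replicate_succ, eWord, leibniz_lie, ih, swap_e, D.lie_e_f_diff j i hij.symm, zero_lie,
      zero_add, if_neg (Nat.succ_ne_zero m)]
    split_ifs <;> simp

/-- The `sl₂` computation on the `f_i`-string through `f_j`, which `e_i` annihilates. The scalar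
vanishes at `m = -a_{ij}`, which dictates the exponent in the Serre relation. -/
theorem lie_e_fWord_left {i j : Fin n} (hij : i ≠ j) (m : ℕ) :
    ⁅D.e i, D.swap.eWord j (List.replicate (m + 1) i)⁆ =
      ((m + 1 : ℂ) * (-A.toMatrix i j - m)) • D.swap.eWord j (List.replicate m i) := by
  have hstep (m : ℕ) : ⁅D.e i, D.swap.eWord j (List.replicate (m + 1) i)⁆ =
      (-(A.toMatrix i j + 2 * m) : ℂ) • D.swap.eWord j (List.replicate m i) +
        ⁅D.f i, ⁅D.e i, D.swap.eWord j (List.replicate m i)⁆⁆ := by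
    rw [List.replicate_succ, eWord, leibniz_lie, swap_e, D.lie_e_f_same,
      D.mem_wtSpace.mp (D.fWord_mem_wtSpace _ _)]
    congr 2
    simp [wordWeight, R.root_coroot, A.diag]
    ring
  induction m with
  | zero =>
    rw [hstep, List.replicate_zero, eWord, swap_e, D.lie_e_f_diff i j hij, lie_zero, add_zero]
    congr 1
    simp
  | succ m ih =>
    rw [hstep, ih, lie_smul]
    have : ⁅D.f i, D.swap.eWord j (List.replicate m i)⁆ =
      D.swap.eWord j (List.replicate (m + 1) i) := rfl
    rw [this, ← add_smul]
    congr 1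
    push_cast
    ring

variable {D}

/-- The Serre relation `(ad f_i)^{1 - a_{ij}} f_j = 0`. -/
theorem IsReduced.fWord_eq_zero (hD : D.IsReduced) {i j : Fin n} (hij : i ≠ j) :
    D.swap.eWord j (List.replicate ((-A.toMatrix i j).toNat + 1) i) = 0 := by
  have hcast : (((-A.toMatrix i j).toNat : ℕ) : ℂ) = -(A.toMatrix i j : ℂ) := by
    have h := Int.toNat_of_nonneg (neg_nonneg.mpr (A.offDiag_nonpos i j hij))
    have h2 : (((-A.toMatrix i j).toNat : ℤ) : ℂ) = ((-A.toMatrix i j : ℤ) : ℂ) := by rw [h]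
    push_cast at h2
    exact h2
  refine hD.eq_zero_of_lie_e_eq_zero (D.fWord_mem_wtSpace _ _) fun k => ?_
  by_cases hki : k = i
  · subst hki
    rw [D.lie_e_fWord_left hij, hcast, sub_self, mul_zero, zero_smul]
  · by_cases hkj : k = j
    · subst hkj
      rw [D.lie_e_fWord_right hij]
      split_ifs with h
      -- An exponent of one means `a_{ij} = 0`, hence `a_{ji} = 0`, and the surviving term has
      -- coefficient `a_{ji}`.
      · have h0 : A.toMatrix i k = 0 := by
          have := A.offDiag_nonpos i k hij
          omega
        rw [R.root_coroot, A.zero_symm i k h0, Int.cast_zero, zero_smul]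
      · rfl
    · exact D.lie_e_fWord_of_ne hki hkj _

/-- `ad e_i` is locally nilpotent. -/
theorem IsReduced.engel_e (hD : D.IsReduced) (i : Fin n) : LieSubalgebra.engel ℂ (D.e i) = ⊤ := by
  have h1 (x : 𝔥) : D.c x ∈ LieSubalgebra.engel ℂ (D.e i) := by
    rw [LieSubalgebra.mem_engel_iff]
    refine ⟨2, ?_⟩
    simp [pow_succ, D.lie_e_c]
  -- The elements killed by a power of `ad e_i` form a subalgebra, so it suffices to test the
  -- generators.
  rw [eq_top_iff, ← D.lieSpan_eq_top, LieSubalgebra.lieSpan_le]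
  rintro _ ((⟨j, rfl⟩ | ⟨j, rfl⟩) | ⟨x, rfl⟩)
  · by_cases hij : i = j
    · rw [hij]; exact LieSubalgebra.self_mem_engel _ _
    · rw [SetLike.mem_coe, LieSubalgebra.mem_engel_iff]
      have h := hD.swap.fWord_eq_zero hij
      rw [swap_swap, ← ad_pow_e_eq_eWord] at h
      exact ⟨_, h⟩
  · rw [SetLike.mem_coe, LieSubalgebra.mem_engel_iff]
    refine ⟨3, ?_⟩
    simp only [pow_succ, pow_zero, one_mul, Module.End.mul_apply, LieAlgebra.ad_apply, D.lie_e_f]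
    split_ifs <;> simp [D.lie_e_c]
  · exact h1 x

theorem IsReduced.engel_f (hD : D.IsReduced) (i : Fin n) : LieSubalgebra.engel ℂ (D.f i) = ⊤ :=
  hD.swap.engel_e i

end Chevalley

theorem isReduced_chevalley (R : A.Realization 𝔥) : R.chevalley.IsReduced :=
  ⟨R.chevalley_c_injective, R.eq_bot_of_cartan_trivial⟩

end GCM.Realization

/-! ### Exponentials of locally nilpotent inner derivations -/

section Exponential

variable {L : Type*} [LieRing L] [LieAlgebra ℂ L]

/-- The formal exponential of `ad x`, as a function. -/
def adExp (x y : L) : L := ∑ᶠ k : ℕ, (k.factorial : ℂ)⁻¹ • (LieAlgebra.ad ℂ L x ^ k) y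

theorem adExp_eq_sum {x y : L} {N : ℕ} (h : (LieAlgebra.ad ℂ L x ^ N) y = 0) :
    adExp x y = ∑ k ∈ Finset.range N, (k.factorial : ℂ)⁻¹ • (LieAlgebra.ad ℂ L x ^ k) y := by
  refine finsum_eq_sum_of_support_subset _ fun k hk => ?_
  rw [Finset.coe_range, Set.mem_Iio]
  by_contra hle
  exact hk (by simp only [Module.End.pow_map_zero_of_le (not_lt.mp hle) h, smul_zero])

theorem exists_ad_pow_eq_zero {x : L} (hx : LieSubalgebra.engel ℂ x = ⊤) (y z : L) :
    ∃ N, (LieAlgebra.ad ℂ L x ^ N) y = 0 ∧ (LieAlgebra.ad ℂ L x ^ N) z = 0 := by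
  obtain ⟨M, hM⟩ := (LieSubalgebra.mem_engel_iff ℂ x y).mp (hx ▸ LieSubalgebra.mem_top y)
  obtain ⟨N, hN⟩ := (LieSubalgebra.mem_engel_iff ℂ x z).mp (hx ▸ LieSubalgebra.mem_top z)
  exact ⟨max M N, Module.End.pow_map_zero_of_le (le_max_left _ _) hM,
    Module.End.pow_map_zero_of_le (le_max_right _ _) hN⟩

/-- `ad x` is a derivation, so the iterated Leibniz rule divided by `k!` is a Cauchy product. If `N`
powers kill both `y` and `z`, then `2N` powers kill the bracket, and all sums are finite. -/
theorem adExp_lie {x : L} (hx : LieSubalgebra.engel ℂ x = ⊤) (y z : L) :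
    adExp x ⁅y, z⁆ = ⁅adExp x y, adExp x z⁆ := by
  obtain ⟨N, hy, hz⟩ := exists_ad_pow_eq_zero hx y z
  set D := LieAlgebra.ad ℂ L x
  have h0 (p : ℕ × ℕ) (hp : N ≤ p.1 ∨ N ≤ p.2) : ⁅(D ^ p.1) y, (D ^ p.2) z⁆ = 0 := by
    rcases hp with h | h
    · rw [Module.End.pow_map_zero_of_le h hy, zero_lie]
    · rw [Module.End.pow_map_zero_of_le h hz, lie_zero]
  have hyz : (D ^ (N + N)) ⁅y, z⁆ = 0 := by
    rw [LieAlgebra.ad_pow_lie]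
    refine Finset.sum_eq_zero fun p hp => ?_
    rw [Finset.HasAntidiagonal.mem_antidiagonal] at hp
    rw [h0 p (by omega), smul_zero]
  set g : ℕ × ℕ → L := fun p =>
    ((p.2.factorial : ℂ)⁻¹ * (p.1.factorial : ℂ)⁻¹) • ⁅(D ^ p.1) y, (D ^ p.2) z⁆
  have hL (k : ℕ) : (k.factorial : ℂ)⁻¹ • (D ^ k) ⁅y, z⁆ =
      ∑ p ∈ Finset.HasAntidiagonal.antidiagonal k, g p := by
    rw [LieAlgebra.ad_pow_lie, Finset.smul_sum]
    refine Finset.sum_congr rfl fun p hp => ?_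
    rw [Finset.HasAntidiagonal.mem_antidiagonal] at hp
    rw [← Nat.cast_smul_eq_nsmul ℂ, smul_smul]
    congr 1
    subst hp
    rw [← Nat.add_choose_mul_factorial_mul_factorial p.1 p.2, Nat.choose_symm_add]
    have h1 : (p.1.factorial : ℂ) ≠ 0 := Nat.cast_ne_zero.mpr p.1.factorial_ne_zero
    have h2 : (p.2.factorial : ℂ) ≠ 0 := Nat.cast_ne_zero.mpr p.2.factorial_ne_zero
    have h3 : ((p.1 + p.2).choose p.2 : ℂ) ≠ 0 :=
      Nat.cast_ne_zero.mpr (Nat.choose_pos (Nat.le_add_left _ _)).ne'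
    push_cast
    field_simp
  rw [adExp_eq_sum hyz, adExp_eq_sum hy, adExp_eq_sum hz]
  rw [Finset.sum_congr rfl fun k _ => hL k]
  have hR : ∑ p ∈ Finset.range N ×ˢ Finset.range N, g p =
      ∑ i ∈ Finset.range N, ∑ j ∈ Finset.range N,
        ⁅(i.factorial : ℂ)⁻¹ • (D ^ i) y, (j.factorial : ℂ)⁻¹ • (D ^ j) z⁆ := by
    rw [Finset.sum_product]
    simp only [g, smul_lie, lie_smul, smul_smul]
  rw [sum_lie_sum, ← hR, ← Finset.sum_fiberwise_of_maps_to (t := Finset.range (N + N))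
    (g := fun p : ℕ × ℕ => p.1 + p.2)]
  · refine Finset.sum_congr rfl fun k _ => (Finset.sum_subset ?_ ?_).symm
    · intro p hp
      exact Finset.HasAntidiagonal.mem_antidiagonal.mpr (Finset.mem_filter.mp hp).2
    · intro p hp hp'
      rw [Finset.HasAntidiagonal.mem_antidiagonal] at hp
      simp only [Finset.mem_filter, Finset.mem_product, Finset.mem_range, hp, and_true,
        not_and_or, not_lt] at hp'
      simp only [g, h0 p hp', smul_zero]
  · intro p hp
    simp only [Finset.mem_product, Finset.mem_range] at hp ⊢
    omega

theorem adExp_add {x : L} (hx : LieSubalgebra.engel ℂ x = ⊤) (y z : L) :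
    adExp x (y + z) = adExp x y + adExp x z := by
  obtain ⟨N, hy, hz⟩ := exists_ad_pow_eq_zero hx y z
  rw [adExp_eq_sum (N := N) (by rw [map_add, hy, hz, add_zero]), adExp_eq_sum hy, adExp_eq_sum hz,
    ← Finset.sum_add_distrib]
  simp only [map_add, smul_add]

theorem adExp_smul {x : L} (hx : LieSubalgebra.engel ℂ x = ⊤) (t : ℂ) (y : L) :
    adExp x (t • y) = t • adExp x y := by
  obtain ⟨N, hy, -⟩ := exists_ad_pow_eq_zero hx y y
  rw [adExp_eq_sum (N := N) (by rw [map_smul, hy, smul_zero]), adExp_eq_sum hy, Finset.smul_sum]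
  simp only [map_smul, smul_comm t]

/-- The exponential of a locally nilpotent inner derivation, as a homomorphism. -/
def adExpHom (x : L) (hx : LieSubalgebra.engel ℂ x = ⊤) : L →ₗ⁅ℂ⁆ L where
  toFun := adExp x
  map_add' := adExp_add hx
  map_smul' := adExp_smul hx
  map_lie' {y z} := adExp_lie hx y z

theorem adExpHom_injective {x : L} (hx : LieSubalgebra.engel ℂ x = ⊤) :
    Function.Injective (adExpHom x hx) := by
  classical
  rw [injective_iff_map_eq_zero]
  intro y hy
  obtain ⟨N, hN, -⟩ := exists_ad_pow_eq_zero hx y y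
  have hex : ∃ N, (LieAlgebra.ad ℂ L x ^ N) y = 0 := ⟨N, hN⟩
  -- With `M + 1` the least power killing `y`, applying the `M`-th power to `exp(ad x) y = 0` leaves
  -- only the nonzero leading term.
  rcases hM : Nat.find hex with _ | M
  · have := Nat.find_spec hex
    rwa [hM] at this
  · have h0 := Nat.find_spec hex
    rw [hM] at h0
    have h1 : (LieAlgebra.ad ℂ L x ^ M) y ≠ 0 := Nat.find_min hex (by omega)
    refine absurd ?_ h1
    have h2 : adExp x y = 0 := hy
    rw [adExp_eq_sum h0, Finset.sum_range_succ'] at h2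
    have h3 := congrArg (LieAlgebra.ad ℂ L x ^ M) h2
    rw [map_add, map_sum, map_zero, Finset.sum_eq_zero] at h3
    · simpa using h3
    · intro k _
      rw [map_smul, ← Module.End.mul_apply, ← pow_add,
        Module.End.pow_map_zero_of_le (by omega) h0, smul_zero]

theorem adExp_of_sq {x y : L} (h : ⁅x, ⁅x, y⁆⁆ = 0) : adExp x y = y + ⁅x, y⁆ := by
  rw [adExp_eq_sum (N := 2) (by simpa [pow_succ] using h)]
  simp [Finset.sum_range_succ]

theorem adExp_of_cube {x y : L} (h : ⁅x, ⁅x, ⁅x, y⁆⁆⁆ = 0) :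
    adExp x y = y + ⁅x, y⁆ + (2 : ℂ)⁻¹ • ⁅x, ⁅x, y⁆⁆ := by
  rw [adExp_eq_sum (N := 3) (by simpa [pow_succ] using h)]
  simp [Finset.sum_range_succ, pow_succ]

theorem engel_neg {x : L} (hx : LieSubalgebra.engel ℂ x = ⊤) :
    LieSubalgebra.engel ℂ (-x) = ⊤ := by
  rw [eq_top_iff]
  intro y _
  obtain ⟨N, hN, -⟩ := exists_ad_pow_eq_zero hx y y
  rw [LieSubalgebra.mem_engel_iff]
  refine ⟨N, ?_⟩
  rw [map_neg, neg_pow, Module.End.mul_apply, hN, map_zero]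

end Exponential

/-! ### Lifting the Weyl group to endomorphisms of the Lie algebra. -/

namespace GCM.Realization

variable {n : ℕ} {A : GCM n} {𝔥 : Type*} [AddCommGroup 𝔥] [Module ℂ 𝔥]

@[simp] theorem root_coroot_self (R : A.Realization 𝔥) (i : Fin n) :
    R.root i (R.coroot i) = 2 := by
  rw [R.root_coroot, A.diag]; norm_num

/-- The simple reflection of `𝔥`. -/
def coreflection (R : A.Realization 𝔥) (i : Fin n) (x : 𝔥) : 𝔥 := x - R.root i x • R.coroot i

theorem coreflection_coreflection (R : A.Realization 𝔥) (i : Fin n) (x : 𝔥) :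
    R.coreflection i (R.coreflection i x) = x := by
  simp only [coreflection, map_sub, map_smul, root_coroot_self, smul_eq_mul]
  module

theorem simpleReflection_apply (R : A.Realization 𝔥) (i : Fin n) (μ : Dual ℂ 𝔥) :
    R.simpleReflection i μ = μ - μ (R.coroot i) • R.root i := by
  simp [simpleReflection, Module.reflection_apply]

theorem simpleReflection_apply_coreflection (R : A.Realization 𝔥) (i : Fin n) (μ : Dual ℂ 𝔥)
    (x : 𝔥) : R.simpleReflection i μ (R.coreflection i x) = μ x := by
  simp only [simpleReflection_apply, coreflection, map_sub, map_smul, LinearMap.sub_apply,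
    LinearMap.smul_apply, root_coroot_self, smul_eq_mul]
  ring

theorem simpleReflection_mul_self (R : A.Realization 𝔥) (i : Fin n) :
    R.simpleReflection i * R.simpleReflection i = 1 := by
  refine LinearEquiv.ext fun μ => ?_
  exact Module.involutive_reflection _ μ

namespace Chevalley

variable {R : A.Realization 𝔥} {L : Type*} [LieRing L] [LieAlgebra ℂ L] {D : Chevalley R L}

variable (D) in
/-- `w` is induced by an injective endomorphism of `L` preserving `𝔥`. -/
def HasLift (w : Dual ℂ 𝔥 ≃ₗ[ℂ] Dual ℂ 𝔥) : Prop :=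
  ∃ (Θ : L →ₗ⁅ℂ⁆ L) (σ : 𝔥 → 𝔥), Function.Injective Θ ∧ Function.Surjective σ ∧
    (∀ x, Θ (D.c x) = D.c (σ x)) ∧ ∀ μ x, w μ (σ x) = μ x

theorem hasLift_one : D.HasLift 1 :=
  ⟨LieHom.id, id, fun _ _ h => h, fun x => ⟨x, rfl⟩, fun _ => rfl, fun _ _ => rfl⟩

theorem HasLift.mul {v w : Dual ℂ 𝔥 ≃ₗ[ℂ] Dual ℂ 𝔥} (hv : D.HasLift v) (hw : D.HasLift w) :
    D.HasLift (v * w) := by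
  obtain ⟨Θ, σ, h1, h2, h3, h4⟩ := hv
  obtain ⟨Θ', σ', h1', h2', h3', h4'⟩ := hw
  exact ⟨Θ.comp Θ', σ ∘ σ', h1.comp h1', h2.comp h2', fun x => by simp [h3, h3'],
    fun μ x => by simp [h4, h4']⟩

/-- The lift is `exp(ad e_i) exp(-ad f_i) exp(ad e_i)`; only its effect on `𝔥` has to be computed.
-/
theorem IsReduced.hasLift_simpleReflection (hD : D.IsReduced) (i : Fin n) :
    D.HasLift (R.simpleReflection i) := by
  have he := hD.engel_e i
  have hf := engel_neg (hD.engel_f i)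
  refine ⟨(adExpHom _ he).comp ((adExpHom _ hf).comp (adExpHom _ he)), R.coreflection i,
    (adExpHom_injective he).comp ((adExpHom_injective hf).comp (adExpHom_injective he)),
    fun x => ⟨_, R.coreflection_coreflection i x⟩, fun x => ?_,
    R.simpleReflection_apply_coreflection i⟩
  have hec (x : 𝔥) : adExpHom _ he (D.c x) = D.c x - R.root i x • D.e i := by
    refine (adExp_of_sq (by simp [D.lie_e_c])).trans ?_
    rw [D.lie_e_c, sub_eq_add_neg]
  have hee : adExpHom _ he (D.e i) = D.e i := (adExp_of_sq (by simp)).trans (by simp)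
  have hfc : adExpHom _ hf (D.c x) = D.c x - R.root i x • D.f i := by
    refine (adExp_of_sq (by simp [D.lie_f_c])).trans ?_
    rw [neg_lie, D.lie_f_c, sub_eq_add_neg]
  have h1 : ⁅-D.f i, D.e i⁆ = D.c (R.coroot i) := by
    rw [neg_lie, lie_skew, D.lie_e_f_same]
  have h2 : ⁅-D.f i, D.c (R.coroot i)⁆ = -((2 : ℂ) • D.f i) := by
    rw [neg_lie, D.lie_f_c, root_coroot_self]
  have hfe : adExpHom _ hf (D.e i) = D.e i + D.c (R.coroot i) - D.f i := by
    refine (adExp_of_cube (by rw [h1, h2]; simp)).trans ?_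
    rw [h1, h2]
    module
  -- The `f_i` terms cancel here; the last exponential then removes the `e_i` term, as `α_i` changes
  -- sign under the reflection.
  have hmid : adExpHom _ hf (D.c x - R.root i x • D.e i) =
      D.c (R.coreflection i x) - R.root i x • D.e i := by
    rw [map_sub, map_smul, hfc, hfe, coreflection, map_sub, map_smul]
    module
  rw [LieHom.comp_apply, LieHom.comp_apply, hec, hmid, map_sub, map_smul, hec, hee]
  have : R.root i (R.coreflection i x) = -R.root i x := by
    simp only [coreflection, map_sub, map_smul, root_coroot_self, smul_eq_mul]
    ring
  rw [this]
  module

theorem map_mem_wtSpace_of_lift {w : Dual ℂ 𝔥 ≃ₗ[ℂ] Dual ℂ 𝔥} {Θ : L →ₗ⁅ℂ⁆ L} {σ : 𝔥 → 𝔥}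
    (hσ : Function.Surjective σ) (hΘ : ∀ x, Θ (D.c x) = D.c (σ x)) (hw : ∀ μ x, w μ (σ x) = μ x)
    {α : Dual ℂ 𝔥} {y : L} (hy : y ∈ D.wtSpace α) : Θ y ∈ D.wtSpace (w α) := by
  rw [mem_wtSpace] at *
  intro x
  obtain ⟨z, rfl⟩ := hσ x
  rw [← hΘ, ← LieHom.map_lie, hy, map_smul, hw]

theorem HasLift.rank_wtSpace_le {w : Dual ℂ 𝔥 ≃ₗ[ℂ] Dual ℂ 𝔥} (hw : D.HasLift w)
    (α : Dual ℂ 𝔥) : Module.rank ℂ (D.wtSpace α) ≤ Module.rank ℂ (D.wtSpace (w α)) := by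
  obtain ⟨Θ, σ, h1, h2, h3, h4⟩ := hw
  refine LinearMap.rank_le_of_injective ((Θ : L →ₗ[ℂ] L).restrict fun y hy =>
    map_mem_wtSpace_of_lift h2 h3 h4 hy) ?_
  intro y z hyz
  exact Subtype.ext (h1 (congrArg Subtype.val hyz))

/-- Injective lifts of `w` and `w⁻¹` bound the dimensions in both directions. Comparing cardinal
ranks avoids any appeal to finite dimensionality of weight spaces. -/
theorem HasLift.finrank_wtSpace {w : Dual ℂ 𝔥 ≃ₗ[ℂ] Dual ℂ 𝔥} (hw : D.HasLift w)
    (hw' : D.HasLift w⁻¹) (α : Dual ℂ 𝔥) :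
    finrank ℂ (D.wtSpace (w α)) = finrank ℂ (D.wtSpace α) := by
  have h := hw'.rank_wtSpace_le (w α)
  have h1 : w⁻¹ (w α) = α := w.symm_apply_apply α
  rw [h1] at h
  exact congrArg Cardinal.toNat (h.antisymm (hw.rank_wtSpace_le α))

/-- A lift of `w` sends `e_i`, `f_i` to multiples of `e_j`, `f_j`, because these span their root
spaces. It therefore sends `α_i^∨` to a multiple of `α_j^∨`, and the pairing `2` with the simple
root forces the scalar to be `1`. -/
theorem IsReduced.mul_simpleReflection_eq (hD : D.IsReduced) {w : Dual ℂ 𝔥 ≃ₗ[ℂ] Dual ℂ 𝔥}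
    (hw : D.HasLift w) {i j : Fin n} (hij : w (R.root i) = R.root j) :
    w * R.simpleReflection i = R.simpleReflection j * w := by
  obtain ⟨Θ, σ, h1, h2, h3, h4⟩ := hw
  obtain ⟨a, ha⟩ : ∃ a : ℂ, a • D.e j = Θ (D.e i) := by
    rw [← Submodule.mem_span_singleton, ← wtSpace_root, ← hij]
    exact map_mem_wtSpace_of_lift h2 h3 h4 (D.e_mem_wtSpace i)
  obtain ⟨b, hb⟩ : ∃ b : ℂ, b • D.f j = Θ (D.f i) := by
    rw [← Submodule.mem_span_singleton, ← swap_e, ← wtSpace_root, swap_wtSpace, ← hij, ← map_neg]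
    exact map_mem_wtSpace_of_lift h2 h3 h4 (D.f_mem_wtSpace i)
  have hσ : σ (R.coroot i) = (a * b) • R.coroot j := by
    apply hD.c_injective
    rw [← h3, ← D.lie_e_f_same, LieHom.map_lie, ← ha, ← hb, smul_lie, lie_smul, smul_smul,
      D.lie_e_f_same, map_smul]
  have hab : a * b = 1 := by
    have := h4 (R.root i) (R.coroot i)
    rw [hij, hσ, map_smul, root_coroot_self, root_coroot_self, smul_eq_mul] at this
    exact mul_right_cancel₀ two_ne_zero (this.trans (one_mul 2).symm)
  rw [hab, one_smul] at hσ
  refine LinearEquiv.ext fun μ => ?_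
  rw [LinearEquiv.mul_apply, LinearEquiv.mul_apply, simpleReflection_apply, simpleReflection_apply,
    map_sub, map_smul, hij, ← hσ, h4]

end Chevalley

end GCM.Realization

namespace GCM.Realization

variable {n : ℕ} {A : GCM n} {𝔥 : Type*} [AddCommGroup 𝔥] [Module ℂ 𝔥] (R : A.Realization 𝔥)

/-! ### Words in the Weyl group -/

/-- The product of the simple reflections in a word. -/
def wordProd (l : List (Fin n)) : Dual ℂ 𝔥 ≃ₗ[ℂ] Dual ℂ 𝔥 := (l.map R.simpleReflection).prod

@[simp] theorem wordProd_nil : R.wordProd [] = 1 := rfl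

@[simp] theorem wordProd_cons (i : Fin n) (l : List (Fin n)) :
    R.wordProd (i :: l) = R.simpleReflection i * R.wordProd l := by simp [wordProd]

@[simp] theorem wordProd_append (l m : List (Fin n)) :
    R.wordProd (l ++ m) = R.wordProd l * R.wordProd m := by simp [wordProd]

theorem wordProd_reverse (l : List (Fin n)) : R.wordProd l.reverse = (R.wordProd l)⁻¹ := by
  have hinv (i) : (R.simpleReflection i)⁻¹ = R.simpleReflection i :=
    inv_eq_of_mul_eq_one_left (R.simpleReflection_mul_self i)
  induction l with
  | nil => simp
  | cons i l ih => simp [ih, hinv]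

theorem exists_wordProd_eq {w : Dual ℂ 𝔥 ≃ₗ[ℂ] Dual ℂ 𝔥} (hw : w ∈ R.weylGroup) :
    ∃ l, R.wordProd l = w := by
  induction hw using Subgroup.closure_induction with
  | mem x hx => obtain ⟨i, rfl⟩ := hx; exact ⟨[i], by simp⟩
  | one => exact ⟨[], rfl⟩
  | mul x y _ _ hx hy =>
    obtain ⟨l, rfl⟩ := hx
    obtain ⟨m, rfl⟩ := hy
    exact ⟨l ++ m, R.wordProd_append l m⟩
  | inv x _ hx =>
    obtain ⟨l, rfl⟩ := hx
    exact ⟨l.reverse, R.wordProd_reverse l⟩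

theorem wordProd_mem_weylGroup (l : List (Fin n)) : R.wordProd l ∈ R.weylGroup := by
  refine list_prod_mem fun x hx => ?_
  obtain ⟨i, -, rfl⟩ := List.mem_map.mp hx
  exact Subgroup.subset_closure ⟨i, rfl⟩

theorem hasLift_wordProd (l : List (Fin n)) : R.chevalley.HasLift (R.wordProd l) := by
  induction l with
  | nil => exact Chevalley.hasLift_one
  | cons i l ih =>
    rw [wordProd_cons]
    exact (R.isReduced_chevalley.hasLift_simpleReflection i).mul ih

/-! ### Positive roots, exchange and inversions. -/

variable {R}

theorem mult_apply {w : Dual ℂ 𝔥 ≃ₗ[ℂ] Dual ℂ 𝔥} (hw : w ∈ R.weylGroup) (α : Dual ℂ 𝔥) :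
    R.mult (w α) = R.mult α := by
  obtain ⟨l, rfl⟩ := R.exists_wordProd_eq hw
  refine (R.hasLift_wordProd l).finrank_wtSpace ?_ α
  rw [← wordProd_reverse]
  exact R.hasLift_wordProd _

theorem simpleReflection_mem_rootLattice (i : Fin n) {α : Dual ℂ 𝔥} (hα : α ∈ R.rootLattice) :
    R.simpleReflection i α ∈ R.rootLattice := by
  induction hα using AddSubgroup.closure_induction with
  | mem x hx =>
    obtain ⟨j, rfl⟩ := hx
    rw [simpleReflection_apply, R.root_coroot, Int.cast_smul_eq_zsmul]
    have hroot (k : Fin n) : R.root k ∈ R.rootLattice := AddSubgroup.subset_closure ⟨k, rfl⟩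
    exact sub_mem (hroot j) (zsmul_mem (hroot i) _)
  | zero => rw [map_zero]; exact zero_mem _
  | add x y _ _ hx hy => rw [map_add]; exact add_mem hx hy
  | neg x _ hx => rw [map_neg]; exact neg_mem hx

theorem apply_mem_rootLattice {w : Dual ℂ 𝔥 ≃ₗ[ℂ] Dual ℂ 𝔥} (hw : w ∈ R.weylGroup)
    {α : Dual ℂ 𝔥} (hα : α ∈ R.rootLattice) : w α ∈ R.rootLattice := by
  obtain ⟨l, rfl⟩ := R.exists_wordProd_eq hw
  induction l with
  | nil => exact hα
  | cons i l ih =>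
    rw [wordProd_cons]
    exact simpleReflection_mem_rootLattice i (ih (R.wordProd_mem_weylGroup l))

theorem apply_mem_roots {w : Dual ℂ 𝔥 ≃ₗ[ℂ] Dual ℂ 𝔥} (hw : w ∈ R.weylGroup)
    {α : Dual ℂ 𝔥} (hα : α ∈ R.roots) : w α ∈ R.roots :=
  ⟨apply_mem_rootLattice hw hα.1, (map_ne_zero_iff w w.injective).mpr hα.2.1, by
    rw [mult_apply hw]; exact hα.2.2⟩

theorem isNeg_iff {α : Dual ℂ 𝔥} : R.IsNeg α ↔ R.IsPos (-α) := by
  rw [IsNeg, IsPos, neg_ne_zero]; rfl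

theorem eq_zero_of_mem_posCone {α : Dual ℂ 𝔥} (h : α ∈ R.posCone) (h' : -α ∈ R.posCone) :
    α = 0 := by
  obtain ⟨k, hk⟩ := R.mem_posCone_iff.mp h
  obtain ⟨l, hl⟩ := R.mem_posCone_iff.mp h'
  have h0 : R.wt (k + l) = R.wt 0 := by rw [wt_add, hk, hl]; simp [wt]
  have h1 := R.wt_injective h0
  rw [add_eq_zero] at h1
  rw [← hk, h1.1]
  simp [wt]

theorem IsPos.not_isNeg {α : Dual ℂ 𝔥} (h : R.IsPos α) : ¬R.IsNeg α := fun h' =>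
  h.2 (eq_zero_of_mem_posCone h.1 h'.1)

theorem isPos_of_not_isNeg {α : Dual ℂ 𝔥} (hα : α ∈ R.roots) (h : ¬R.IsNeg α) : R.IsPos α := by
  have hne : R.chevalley.wtSpace α ≠ ⊥ := by
    intro h0
    apply hα.2.2
    rw [mult, ← wtSpace_chevalley, h0, finrank_bot]
  rcases R.chevalley.mem_posCone_or_of_wtSpace_ne_bot hne hα.2.1 with h1 | h1
  · exact ⟨h1, hα.2.1⟩
  · exact absurd ⟨h1, hα.2.1⟩ h

theorem mem_posRoots_of_not_isNeg {α : Dual ℂ 𝔥} (hα : α ∈ R.roots) (h : ¬R.IsNeg α) :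
    α ∈ R.posRoots := ⟨hα, isPos_of_not_isNeg hα h⟩

variable (R) in
theorem isPos_root (i : Fin n) : R.IsPos (R.root i) :=
  ⟨AddSubmonoid.subset_closure ⟨i, rfl⟩, R.root_ne_zero i⟩

variable (R) in
theorem mult_root (i : Fin n) : R.mult (R.root i) = 1 := by
  rw [mult, ← wtSpace_chevalley, Chevalley.wtSpace_root]
  refine finrank_span_singleton fun h => R.linearIndependent_coroot.ne_zero i ?_
  apply R.chevalley_c_injective
  rw [← R.chevalley.lie_e_f_same, h, zero_lie, map_zero]

variable (R) in
theorem mult_neg_root (i : Fin n) : R.mult (-R.root i) = 1 := by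
  rw [mult, ← wtSpace_chevalley, ← Chevalley.swap_wtSpace, Chevalley.wtSpace_root]
  refine finrank_span_singleton fun h => R.linearIndependent_coroot.ne_zero i ?_
  apply R.chevalley_c_injective
  rw [Chevalley.swap_e] at h
  rw [← R.chevalley.lie_e_f_same, h, lie_zero, map_zero]

variable (R) in
theorem root_mem_posRoots (i : Fin n) : R.root i ∈ R.posRoots :=
  ⟨⟨AddSubgroup.subset_closure ⟨i, rfl⟩, R.root_ne_zero i, by rw [mult_root]; exact one_ne_zero⟩,
    R.isPos_root i⟩

theorem wt_eq_sum (k : Fin n →₀ ℕ) : R.wt k = ∑ i, (k i : ℂ) • R.root i := by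
  simp only [wt, Nat.cast_smul_eq_nsmul]

/-- A simple reflection `s_i` permutes the positive roots other than `α_i`. -/
theorem simpleReflection_mem_posRoots {i : Fin n} {β : Dual ℂ 𝔥} (hβ : β ∈ R.posRoots)
    (hne : β ≠ R.root i) : R.simpleReflection i β ∈ R.posRoots := by
  have hs : R.simpleReflection i ∈ R.weylGroup := Subgroup.subset_closure ⟨i, rfl⟩
  refine mem_posRoots_of_not_isNeg (apply_mem_roots hs hβ.1) fun hneg => ?_
  obtain ⟨k, hk⟩ := R.mem_posCone_iff.mp hβ.2.1
  obtain ⟨l, hl⟩ := R.mem_posCone_iff.mp hneg.1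
  -- `β - s_i β` is a multiple of `α_i`, so if `s_i β` were negative, the coefficients of `β` away
  -- from `i` would vanish and `β` would be a multiple of `α_i`.
  have h1 : ∑ j, ((k + l) j : ℂ) • R.root j =
      ∑ j, (if j = i then β (R.coroot i) else 0) • R.root j := by
    rw [← wt_eq_sum, wt_add, hk, hl, simpleReflection_apply]
    simp [ite_smul]
  rw [wt_eq_wt_iff] at h1
  have h2 (j) (hj : j ≠ i) : k j = 0 := by
    have := congrFun h1 j
    rw [if_neg hj, Nat.cast_eq_zero, Finsupp.add_apply] at this
    omega
  have h3 : β = k i • R.root i := by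
    rw [← hk, wt, Finset.sum_eq_single i]
    · intro j _ hj
      rw [h2 j hj, zero_smul]
    · simp
  rcases hki : k i with _ | _ | m
  · rw [hki, zero_smul] at h3
    exact hβ.2.2 h3
  · rw [hki, zero_add, one_smul] at h3
    exact hne h3
  · apply hβ.1.2.2
    rw [mult, ← wtSpace_chevalley, h3, hki, Chevalley.wtSpace_nsmul_root, finrank_bot]

/-- The exchange property. -/
theorem exists_wordProd_eq_mul_simpleReflection {l : List (Fin n)} {i : Fin n}
    (h : R.IsNeg (R.wordProd l (R.root i))) :
    ∃ m : List (Fin n), m.length < l.length ∧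
      R.wordProd m = R.wordProd l * R.simpleReflection i := by
  induction l with
  | nil => exact absurd h (R.isPos_root i).not_isNeg
  | cons j l ih =>
    by_cases hl : R.IsNeg (R.wordProd l (R.root i))
    · obtain ⟨m, hm, hm'⟩ := ih hl
      exact ⟨j :: m, by simpa using hm, by rw [wordProd_cons, wordProd_cons, hm', mul_assoc]⟩
    · have hpos : R.wordProd l (R.root i) ∈ R.posRoots := mem_posRoots_of_not_isNeg
        (apply_mem_roots (R.wordProd_mem_weylGroup l) (R.root_mem_posRoots i).1) hl
      -- The letter `s_j` makes this positive root negative, so the root must be `α_j`. Conjugation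
      -- then turns `s_j v s_i` into `s_j s_j v = v`.
      have heq : R.wordProd l (R.root i) = R.root j := by
        by_contra hne
        rw [wordProd_cons, LinearEquiv.mul_apply] at h
        exact (simpleReflection_mem_posRoots hpos hne).2.not_isNeg h
      refine ⟨l, by simp, ?_⟩
      rw [wordProd_cons, mul_assoc,
        R.isReduced_chevalley.mul_simpleReflection_eq (R.hasLift_wordProd l) heq, ← mul_assoc,
        R.simpleReflection_mul_self, one_mul]

theorem exists_wordProd_length {w : Dual ℂ 𝔥 ≃ₗ[ℂ] Dual ℂ 𝔥} (hw : w ∈ R.weylGroup) :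
    ∃ l, R.wordProd l = w ∧ l.length = R.length w ∧
      ∀ m, R.wordProd m = w → l.length ≤ m.length := by
  have hne : {k | ∃ l : List (Fin n), l.length = k ∧
      (l.map R.simpleReflection).prod = w}.Nonempty := by
    obtain ⟨l, hl⟩ := R.exists_wordProd_eq hw
    exact ⟨_, l, rfl, hl⟩
  obtain ⟨l, h1, h2⟩ := Nat.sInf_mem hne
  refine ⟨l, h2, h1, fun m hm => ?_⟩
  rw [h1]
  exact Nat.sInf_le ⟨m, rfl, hm⟩

/-- The inversions of a reduced word. -/
theorem exists_inversions {ρ : Dual ℂ 𝔥} (hρ : R.IsWeylVector ρ) (l : List (Fin n))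
    (hl : ∀ m, R.wordProd m = R.wordProd l → l.length ≤ m.length) :
    ∃ N : Finset (Dual ℂ 𝔥), (∀ β, β ∈ N ↔ β ∈ R.posRoots ∧ R.IsNeg (R.wordProd l β)) ∧
      N.card = l.length ∧ (∀ β ∈ N, R.mult β = 1 ∧ R.mult (-β) = 1) ∧
      ∑ β ∈ N, R.wordProd l β = R.wordProd l ρ - ρ := by
  classical
  induction l using List.reverseRecOn with
  | nil =>
    refine ⟨∅, fun β => ?_, rfl, by simp, by simp⟩
    simp only [Finset.notMem_empty, false_iff, not_and]
    exact fun h => h.2.not_isNeg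
  | append_singleton l i ih =>
    have hsi : R.simpleReflection i ∈ R.weylGroup := Subgroup.subset_closure ⟨i, rfl⟩
    have hss (μ : Dual ℂ 𝔥) : R.simpleReflection i (R.simpleReflection i μ) = μ :=
      LinearEquiv.congr_fun (R.simpleReflection_mul_self i) μ
    have hsi' : R.simpleReflection i (R.root i) = -R.root i := by
      rw [simpleReflection_apply, root_coroot_self]
      module
    obtain ⟨N, hN, hcard, hmult, hsum⟩ := ih fun m hm => by
      have := hl (m ++ [i]) (by rw [wordProd_append, wordProd_append, hm])
      simpa using this
    set v := R.wordProd l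
    have hw (μ : Dual ℂ 𝔥) : R.wordProd (l ++ [i]) μ = v (R.simpleReflection i μ) := by
      rw [wordProd_append, wordProd_cons, wordProd_nil, mul_one, LinearEquiv.mul_apply]
    -- Otherwise exchange would give a shorter word for `v s_i`.
    have hvi : ¬R.IsNeg (v (R.root i)) := by
      intro hneg
      obtain ⟨m, hm, hm'⟩ := exists_wordProd_eq_mul_simpleReflection hneg
      have := hl m (by rw [hm', wordProd_append, wordProd_cons, wordProd_nil, mul_one])
      rw [List.length_append, List.length_singleton] at this
      omega
    have hvi' : R.IsPos (v (R.root i)) := isPos_of_not_isNeg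
      (apply_mem_roots (R.wordProd_mem_weylGroup l) (R.root_mem_posRoots i).1) hvi
    have hiN : R.root i ∉ N := fun h => hvi ((hN _).mp h).2
    have hiN' : R.root i ∉ N.image (R.simpleReflection i) := by
      intro h
      obtain ⟨γ, hγ, hγi⟩ := Finset.mem_image.mp h
      have h1 : γ = -R.root i := by rw [← hss γ, hγi, hsi']
      have h2 := ((hN _).mp hγ).1.2
      rw [h1] at h2
      exact (R.isPos_root i).not_isNeg (isNeg_iff.mpr h2)
    -- For `w = v s_i` longer than `v`, the inversions are `α_i` and the `s_i`-images of those of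
    -- `v`. The new root adds `-vα_i` to the sum, matching `v s_i ρ = vρ - vα_i`.
    refine ⟨insert (R.root i) (N.image (R.simpleReflection i)), fun β => ?_, ?_, ?_, ?_⟩
    · rw [Finset.mem_insert, Finset.mem_image, hw]
      constructor
      · rintro (rfl | ⟨γ, hγ, rfl⟩)
        · refine ⟨R.root_mem_posRoots i, ?_⟩
          rw [hsi', map_neg, isNeg_iff, neg_neg]
          exact hvi'
        · rw [hss]
          exact ⟨simpleReflection_mem_posRoots ((hN _).mp hγ).1 fun h => hiN (h ▸ hγ),
            ((hN _).mp hγ).2⟩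
      · rintro ⟨h1, h2⟩
        by_cases hβ : β = R.root i
        · exact Or.inl hβ
        · exact Or.inr ⟨_, (hN _).mpr ⟨simpleReflection_mem_posRoots h1 hβ, h2⟩, hss β⟩
    · rw [Finset.card_insert_of_notMem hiN',
        Finset.card_image_of_injective _ (R.simpleReflection i).injective, hcard,
        List.length_append, List.length_singleton]
    · intro β hβ
      obtain rfl | hβ := Finset.mem_insert.mp hβ
      · exact ⟨R.mult_root i, R.mult_neg_root i⟩
      · obtain ⟨γ, hγ, rfl⟩ := Finset.mem_image.mp hβ
        rw [← map_neg, mult_apply hsi, mult_apply hsi]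
        exact hmult γ hγ
    · rw [Finset.sum_insert hiN',
        Finset.sum_image fun _ _ _ _ h => (R.simpleReflection i).injective h]
      simp only [hw, hss, hsum, hsi', simpleReflection_apply R i ρ, hρ i, one_smul, map_sub,
        map_neg]
      abel

end GCM.Realization

namespace GCM.Realization

variable {n : ℕ} {A : GCM n} {𝔥 : Type*} [AddCommGroup 𝔥] [Module ℂ 𝔥] (R : A.Realization 𝔥)

/-! ### The coefficients of the formal product -/

theorem wt_sum {ι : Type*} (s : Finset ι) (k : ι → Fin n →₀ ℕ) :
    R.wt (∑ x ∈ s, k x) = ∑ x ∈ s, R.wt (k x) :=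
  map_sum (⟨⟨R.wt, by simp [wt]⟩, R.wt_add⟩ : (Fin n →₀ ℕ) →+ Dual ℂ 𝔥) k s

theorem mem_partitions {μ : Dual ℂ 𝔥} {p : Finset (Dual ℂ 𝔥 × ℕ)} :
    p ∈ R.partitions μ ↔ (p : Set (Dual ℂ 𝔥 × ℕ)) ⊆ R.parts ∧ ∑ x ∈ p, x.1 = μ := by
  rw [partitions, Set.Finite.mem_toFinset]; rfl

theorem finite_coords_le (d : Fin n →₀ ℕ) : {α : R.posRoots | R.coords α ≤ d}.Finite := by
  refine Set.Finite.of_injOn (f := fun α : R.posRoots => R.coords α) (t := Set.Iic d)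
    (fun α hα => hα) ?_ (Set.finite_Iic d)
  intro α _ β _ hαβ
  apply Subtype.ext
  have := congrArg R.wt hαβ
  rwa [R.wt_coords α.2.2.1, R.wt_coords β.2.2.1] at this

-- With discrete coefficients, convergence means that each coefficient of the partial products is
-- eventually constant. The finite set can thus be taken to contain every root that could
-- contribute.
open scoped MvPowerSeries.WithPiTopology in
theorem exists_coeff_genSeries_eq (d : Fin n →₀ ℕ) :
    ∃ s : Finset R.posRoots, (∀ α : R.posRoots, R.coords α ≤ d → α ∈ s) ∧
      MvPowerSeries.coeff d R.genSeries = MvPowerSeries.coeff d (∏ α ∈ s, R.factor α) := by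
  let : TopologicalSpace (Polynomial ℤ) := ⊥
  have : DiscreteTopology (Polynomial ℤ) := ⟨rfl⟩
  have h1 : HasProd (fun α : R.posRoots => R.factor α) R.genSeries := R.multipliable_factor.hasProd
  have h2 := ((MvPowerSeries.WithPiTopology.continuous_coeff (Polynomial ℤ) d).tendsto
    R.genSeries).comp h1
  rw [nhds_discrete, Filter.tendsto_pure] at h2
  obtain ⟨s, hs⟩ := (h2.and (Filter.eventually_ge_atTop (R.finite_coords_le d).toFinset)).exists
  exact ⟨s, fun α hα => hs.2 ((R.finite_coords_le d).mem_toFinset.mpr hα), hs.1.symm⟩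

theorem prod_parts_eq (t : Finset (Dual ℂ 𝔥 × ℕ)) :
    ∏ x ∈ t, (-(MvPowerSeries.C Polynomial.X * R.expNeg x.1)) =
      MvPowerSeries.monomial (∑ x ∈ t, R.coords x.1) ((-Polynomial.X) ^ t.card) := by
  have h (x : Dual ℂ 𝔥 × ℕ) : -(MvPowerSeries.C Polynomial.X * R.expNeg x.1) =
      MvPowerSeries.monomial (R.coords x.1) (-Polynomial.X : Polynomial ℤ) := by
    rw [expNeg, ← MvPowerSeries.monomial_zero_eq_C_apply, MvPowerSeries.monomial_mul_monomial,
      zero_add, mul_one, map_neg]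
  rw [Finset.prod_congr rfl fun x _ => h x, MvPowerSeries.prod_monomial, Finset.prod_const]

theorem coeff_genSeries {μ : Dual ℂ 𝔥} (hμ : μ ∈ R.posCone) :
    MvPowerSeries.coeff (R.coords μ) R.genSeries =
      ∑ p ∈ R.partitions μ, (-Polynomial.X) ^ p.card := by
  classical
  obtain ⟨s, hs, hcoeff⟩ := R.exists_coeff_genSeries_eq (R.coords μ)
  -- Splitting each power into `m(α)` equal factors indexes the product by parts; its expansion then
  -- runs over subsets of `T`.
  set T : Finset (Dual ℂ 𝔥 × ℕ) :=
    s.biUnion fun α => (Finset.Icc 1 (R.mult α)).image fun j => ((α : Dual ℂ 𝔥), j)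
  have hT (x : Dual ℂ 𝔥 × ℕ) : x ∈ T ↔
      x.1 ∈ s.map (Function.Embedding.subtype _) ∧ x.2 ∈ Finset.Icc 1 (R.mult x.1) := by
    simp only [T, Finset.mem_biUnion, Finset.mem_image, Finset.mem_map,
      Function.Embedding.subtype_apply]
    constructor
    · rintro ⟨α, hα, j, hj, rfl⟩
      exact ⟨⟨α, hα, rfl⟩, hj⟩
    · rintro ⟨⟨α, hα, h⟩, hj⟩
      exact ⟨α, hα, x.2, by rwa [h], by rw [h]⟩
  have hprod : ∏ α ∈ s, R.factor α =
      ∏ x ∈ T, (1 + -(MvPowerSeries.C Polynomial.X * R.expNeg x.1)) := by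
    rw [Finset.prod_finset_product T (s.map (Function.Embedding.subtype _))
      (fun α => Finset.Icc 1 (R.mult α)) hT, Finset.prod_map]
    refine Finset.prod_congr rfl fun α _ => ?_
    simp [factor, sub_eq_add_neg]
  have hfilter : T.powerset.filter (fun t => R.coords μ = ∑ x ∈ t, R.coords x.1) =
      R.partitions μ := by
    ext t
    rw [Finset.mem_filter, Finset.mem_powerset, mem_partitions]
    have hsum (ht : (t : Set (Dual ℂ 𝔥 × ℕ)) ⊆ R.parts) :
        R.wt (∑ x ∈ t, R.coords x.1) = ∑ x ∈ t, x.1 := by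
      rw [wt_sum]
      exact Finset.sum_congr rfl fun x hx => R.wt_coords (ht hx).1.2.1
    constructor
    · rintro ⟨h1, h2⟩
      have ht : (t : Set (Dual ℂ 𝔥 × ℕ)) ⊆ R.parts := by
        intro x hx
        obtain ⟨h3, h4⟩ := (hT x).mp (h1 hx)
        obtain ⟨α, -, h5⟩ := Finset.mem_map.mp h3
        exact ⟨h5 ▸ α.2, Finset.mem_Icc.mp h4⟩
      exact ⟨ht, by rw [← hsum ht, ← h2, R.wt_coords hμ]⟩
    · rintro ⟨ht, h2⟩
      have h3 : R.coords μ = ∑ x ∈ t, R.coords x.1 := by rw [← h2, ← hsum ht, coords_wt]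
      refine ⟨fun x hx => (hT x).mpr ⟨?_, Finset.mem_Icc.mpr (ht hx).2⟩, h3⟩
      refine Finset.mem_map.mpr ⟨⟨x.1, (ht hx).1⟩, hs _ ?_, rfl⟩
      rw [h3]
      exact Finset.single_le_sum (f := fun x : Dual ℂ 𝔥 × ℕ => R.coords x.1)
        (fun _ _ => zero_le) hx
  rw [hcoeff, hprod, Finset.prod_one_add, map_sum, ← hfilter, Finset.sum_filter]
  refine Finset.sum_congr rfl fun t _ => ?_
  rw [prod_parts_eq, MvPowerSeries.coeff_monomial]

/-- `H(μ) = ∑_{𝔭 ∈ 𝒫(μ)} (-q)^{|𝔭|}`. -/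
theorem H_eq_sum (μ : Dual ℂ 𝔥) :
    R.H μ = ∑ p ∈ R.partitions μ, (-Polynomial.X) ^ p.card := by
  rw [H]
  split_ifs with hμ
  · exact R.coeff_genSeries hμ
  · refine (Finset.sum_eq_zero fun p hp => ?_).symm
    obtain ⟨h1, h2⟩ := R.mem_partitions.mp hp
    exact absurd (h2 ▸ sum_mem fun x hx => (h1 hx).1.2.1) hμ

end GCM.Realization

namespace GCM.Realization

variable {n : ℕ} {A : GCM n} {𝔥 : Type*} [AddCommGroup 𝔥] [Module ℂ 𝔥] {R : A.Realization 𝔥}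

/-! ### The action of the Weyl group on admissible partitions -/

open Classical in
variable (R) in
/-- The map `(β; j) ↦ (±wβ; j)` on parts, with the sign that makes `±wβ` positive. -/
def partMap (w : Dual ℂ 𝔥 ≃ₗ[ℂ] Dual ℂ 𝔥) (x : Dual ℂ 𝔥 × ℕ) : Dual ℂ 𝔥 × ℕ :=
  (if R.IsNeg (w x.1) then -w x.1 else w x.1, x.2)

theorem mult_eq_one_of_isNeg {ρ : Dual ℂ 𝔥} (hρ : R.IsWeylVector ρ)
    {w : Dual ℂ 𝔥 ≃ₗ[ℂ] Dual ℂ 𝔥} (hw : w ∈ R.weylGroup) {β : Dual ℂ 𝔥} (hβ : β ∈ R.posRoots)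
    (hneg : R.IsNeg (w β)) : R.mult β = 1 ∧ R.mult (-β) = 1 := by
  obtain ⟨l, rfl, -, hl⟩ := exists_wordProd_length hw
  obtain ⟨N, hN, -, hmult, -⟩ := exists_inversions hρ l hl
  exact hmult β ((hN β).mpr ⟨hβ, hneg⟩)

/-- Changing sign respects the index bound because `m(β) = m(-β) = 1` for inversions; the symmetry
`m(-α) = m(α)` is not needed for other roots. -/
theorem partMap_mem_parts {ρ : Dual ℂ 𝔥} (hρ : R.IsWeylVector ρ)
    {w : Dual ℂ 𝔥 ≃ₗ[ℂ] Dual ℂ 𝔥} (hw : w ∈ R.weylGroup) {x : Dual ℂ 𝔥 × ℕ} (hx : x ∈ R.parts) :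
    R.partMap w x ∈ R.parts := by
  obtain ⟨h1, h2, h3⟩ := hx
  rw [partMap]
  split_ifs with hneg
  · obtain ⟨h4, h5⟩ := mult_eq_one_of_isNeg hρ hw h1 hneg
    have h6 : R.mult (-w x.1) = 1 := by rw [← map_neg, mult_apply hw, h5]
    refine ⟨⟨⟨neg_mem (apply_mem_rootLattice hw h1.1.1), neg_ne_zero.mpr hneg.2, ?_⟩,
      isNeg_iff.mp hneg⟩, h2, ?_⟩
    · rw [h6]; exact one_ne_zero
    · rw [h6, ← h4]; exact h3
  · exact ⟨mem_posRoots_of_not_isNeg (apply_mem_roots hw h1.1) hneg, h2, by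
      rw [mult_apply hw]; exact h3⟩

/-- If the sign was changed, `v` sends `-wβ` to `-β < 0`, and the sign is changed back. -/
theorem partMap_inv_partMap {v w : Dual ℂ 𝔥 ≃ₗ[ℂ] Dual ℂ 𝔥} (hvw : v * w = 1)
    {x : Dual ℂ 𝔥 × ℕ} (hx : x ∈ R.parts) : R.partMap v (R.partMap w x) = x := by
  have hv (μ) : v (w μ) = μ := LinearEquiv.congr_fun hvw μ
  have hpos := hx.1.2
  have hpos' : R.IsNeg (-x.1) := isNeg_iff.mpr (by rwa [neg_neg])
  by_cases h1 : R.IsNeg (w x.1)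
  · rw [partMap, partMap, if_pos h1]
    dsimp only
    rw [map_neg, hv, if_pos hpos', neg_neg]
  · rw [partMap, partMap, if_neg h1]
    dsimp only
    rw [hv, if_neg hpos.not_isNeg]

theorem image_partMap_image {v w : Dual ℂ 𝔥 ≃ₗ[ℂ] Dual ℂ 𝔥} [DecidableEq (Dual ℂ 𝔥)]
    (hvw : v * w = 1) {p : Finset (Dual ℂ 𝔥 × ℕ)} (hp : (p : Set (Dual ℂ 𝔥 × ℕ)) ⊆ R.parts) :
    (p.image (R.partMap w)).image (R.partMap v) = p := by
  rw [Finset.image_image]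
  refine (Finset.image_congr fun x hx => ?_).trans Finset.image_id
  exact partMap_inv_partMap hvw (hp hx)

theorem image_partMap_subset {ρ : Dual ℂ 𝔥} (hρ : R.IsWeylVector ρ)
    {w : Dual ℂ 𝔥 ≃ₗ[ℂ] Dual ℂ 𝔥} [DecidableEq (Dual ℂ 𝔥)] (hw : w ∈ R.weylGroup)
    {p : Finset (Dual ℂ 𝔥 × ℕ)} (hp : (p : Set (Dual ℂ 𝔥 × ℕ)) ⊆ R.parts) :
    (p.image (R.partMap w) : Set (Dual ℂ 𝔥 × ℕ)) ⊆ R.parts := by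
  intro x hx
  obtain ⟨y, hy, rfl⟩ := Finset.mem_image.mp (Finset.mem_coe.mp hx)
  exact partMap_mem_parts hρ hw (hp hy)

theorem partMap_injOn (w : Dual ℂ 𝔥 ≃ₗ[ℂ] Dual ℂ 𝔥) {p : Finset (Dual ℂ 𝔥 × ℕ)}
    (hp : (p : Set (Dual ℂ 𝔥 × ℕ)) ⊆ R.parts) : Set.InjOn (R.partMap w) p := by
  intro x hx y hy h
  rw [← partMap_inv_partMap (inv_mul_cancel w) (hp hx), h,
    partMap_inv_partMap (inv_mul_cancel w) (hp hy)]

open scoped symmDiff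

/-- The terms from `p ∩ N` cancel in the difference on the right. -/
theorem sum_symmDiff_ite {ι M : Type*} [DecidableEq ι] [AddCommGroup M] (p N : Finset ι)
    (g : ι → M) : ∑ x ∈ p ∆ N, (if x ∈ N then -g x else g x) = ∑ x ∈ p, g x - ∑ x ∈ N, g x := by
  have hd : Disjoint (p \ N) (N \ p) := disjoint_sdiff_sdiff
  have h1 : ∑ x ∈ p \ N, (if x ∈ N then -g x else g x) = ∑ x ∈ p \ N, g x :=
    Finset.sum_congr rfl fun x hx => if_neg (Finset.mem_sdiff.mp hx).2
  have h2 : ∑ x ∈ N \ p, (if x ∈ N then -g x else g x) = -∑ x ∈ N \ p, g x := by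
    rw [← Finset.sum_neg_distrib]
    exact Finset.sum_congr rfl fun x hx => if_pos (Finset.mem_sdiff.mp hx).1
  rw [symmDiff_def, Finset.sup_eq_union, Finset.sum_union hd, h1, h2,
    ← Finset.sum_inter_add_sum_sdiff p N g, ← Finset.sum_inter_add_sum_sdiff N p g,
    Finset.inter_comm N p]
  abel

theorem card_symmDiff_eq {ι : Type*} [DecidableEq ι] (p N : Finset ι) :
    ((p ∆ N).card : ℤ) = p.card + N.card - 2 * (p ∩ N).card := by
  have hd : Disjoint (p \ N) (N \ p) := disjoint_sdiff_sdiff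
  have h1 := Finset.card_sdiff_add_card_inter p N
  have h2 := Finset.card_sdiff_add_card_inter N p
  rw [Finset.inter_comm N p] at h2
  rw [symmDiff_def, Finset.sup_eq_union, Finset.card_union_of_disjoint hd]
  omega

/-- The bijection behind the functional equation for `H`, as an identity of sums. -/
theorem sum_partitions_circ {ρ : Dual ℂ 𝔥} (hρ : R.IsWeylVector ρ) (lam : Dual ℂ 𝔥)
    {w : Dual ℂ 𝔥 ≃ₗ[ℂ] Dual ℂ 𝔥} (hw : w ∈ R.weylGroup) {M : Type*} [AddCommMonoid M]
    (g : ℤ → M) :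
    ∑ p ∈ R.partitions (-circ ρ w lam), g p.card =
      ∑ p ∈ R.partitions (-lam), g (R.length w + R.mExp p w) := by
  classical
  obtain ⟨l, rfl, hlen, hl⟩ := exists_wordProd_length hw
  obtain ⟨N, hN, hcard, hmult, hsum⟩ := exists_inversions hρ l hl
  set w := R.wordProd l
  -- Inversions have multiplicity one, so these are all the parts lying over `N`.
  set N' : Finset (Dual ℂ 𝔥 × ℕ) := N.image fun β => (β, 1)
  have hinj : Set.InjOn (fun β : Dual ℂ 𝔥 => (β, 1)) (N : Set (Dual ℂ 𝔥)) :=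
    fun _ _ _ _ h => congrArg Prod.fst h
  have hN'sub : (N' : Set (Dual ℂ 𝔥 × ℕ)) ⊆ R.parts := by
    intro x hx
    obtain ⟨β, hβ, rfl⟩ := Finset.mem_image.mp (Finset.mem_coe.mp hx)
    exact ⟨((hN β).mp hβ).1, le_rfl, (hmult β hβ).1.ge⟩
  have hN' {x : Dual ℂ 𝔥 × ℕ} (hx : x ∈ R.parts) : x ∈ N' ↔ R.IsNeg (w x.1) := by
    constructor
    · intro h
      obtain ⟨β, hβ, rfl⟩ := Finset.mem_image.mp h
      exact ((hN β).mp hβ).2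
    · intro h
      have hβ := (hN x.1).mpr ⟨hx.1, h⟩
      have h2 : x.2 = 1 := le_antisymm ((hmult _ hβ).1 ▸ hx.2.2) hx.2.1
      exact Finset.mem_image.mpr ⟨x.1, hβ, by rw [← h2]⟩
  have hN'card : (N'.card : ℤ) = R.length w := by
    rw [Finset.card_image_of_injOn hinj, hcard, hlen]
  have hsub {p : Finset (Dual ℂ 𝔥 × ℕ)} (hp : (p : Set (Dual ℂ 𝔥 × ℕ)) ⊆ R.parts) :
      ((p ∆ N' : Finset _) : Set (Dual ℂ 𝔥 × ℕ)) ⊆ R.parts := by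
    intro x hx
    rcases Finset.mem_symmDiff.mp (Finset.mem_coe.mp hx) with h | h
    · exact hp h.1
    · exact hN'sub h.1
  have hsumT {p : Finset (Dual ℂ 𝔥 × ℕ)} (hp : (p : Set (Dual ℂ 𝔥 × ℕ)) ⊆ R.parts) :
      ∑ x ∈ (p ∆ N').image (R.partMap w), x.1 = w (∑ x ∈ p, x.1) - (w ρ - ρ) := by
    rw [Finset.sum_image (partMap_injOn w (hsub hp)), ← hsum, map_sum]
    have h1 : ∑ β ∈ N, w β = ∑ x ∈ N', w x.1 :=
      (Finset.sum_image (f := fun x : Dual ℂ 𝔥 × ℕ => w x.1) hinj).symm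
    rw [h1, ← sum_symmDiff_ite p N' fun x => w x.1]
    refine Finset.sum_congr rfl fun x hx => ?_
    simp only [partMap, hN' (hsub hp hx)]
  have hcirc : -circ ρ w lam = w (-lam) - (w ρ - ρ) := by
    rw [circ, map_add, map_neg]; abel
  -- Both the toggle by `N'` and the signed action of `w` are invertible, so the inverse performs
  -- them in the opposite order.
  refine (Finset.sum_nbij' (fun p => (p ∆ N').image (R.partMap w))
    (fun q => (q.image (R.partMap w⁻¹)) ∆ N') ?_ ?_ ?_ ?_ ?_).symm
  · intro p hp
    obtain ⟨h1, h2⟩ := R.mem_partitions.mp hp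
    exact R.mem_partitions.mpr ⟨image_partMap_subset hρ hw (hsub h1), by rw [hsumT h1, h2, hcirc]⟩
  · intro q hq
    obtain ⟨h1, h2⟩ := R.mem_partitions.mp hq
    have h3 := image_partMap_subset hρ (inv_mem hw) h1
    refine R.mem_partitions.mpr ⟨hsub h3, ?_⟩
    have h4 := hsumT (hsub h3)
    rw [symmDiff_symmDiff_cancel_right, image_partMap_image (mul_inv_cancel w) h1, h2, hcirc,
      sub_left_inj] at h4
    exact (w.injective h4).symm
  · intro p hp
    obtain ⟨h1, -⟩ := R.mem_partitions.mp hp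
    rw [image_partMap_image (inv_mul_cancel w) (hsub h1), symmDiff_symmDiff_cancel_right]
  · intro q hq
    obtain ⟨h1, -⟩ := R.mem_partitions.mp hq
    rw [symmDiff_symmDiff_cancel_right, image_partMap_image (mul_inv_cancel w) h1]
  · intro p hp
    obtain ⟨h1, -⟩ := R.mem_partitions.mp hp
    rw [Finset.card_image_of_injOn (partMap_injOn w (hsub h1)), card_symmDiff_eq, hN'card, mExp]
    have h2 : p.filter (fun x => R.IsNeg (w x.1)) = p ∩ N' := by
      ext x
      rw [Finset.mem_filter, Finset.mem_inter]
      exact and_congr_right fun hx => (hN' (h1 hx)).symm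
    rw [h2]
    congr 1
    ring

end GCM.Realization

end

/-! ### The functional equation for `H`. -/

theorem mainTheorem5 {n : ℕ} {A : GCM n} {𝔥 : Type*} [AddCommGroup 𝔥] [Module ℂ 𝔥]
    [FiniteDimensional ℂ 𝔥] (R : A.Realization 𝔥)
    (ρ : Module.Dual ℂ 𝔥) (hρ : R.IsWeylVector ρ)
    (lam : Module.Dual ℂ 𝔥) (hlam : lam ∈ R.negCone)
    (w : Module.Dual ℂ 𝔥 ≃ₗ[ℂ] Module.Dual ℂ 𝔥) (hw : w ∈ R.weylGroup) :
    (-1 : ℤ[T;T⁻¹]) ^ R.length w *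
        Polynomial.toLaurent (R.H (-(GCM.Realization.circ ρ w lam))) =
      LaurentPolynomial.T 1 ^ R.length w *
        ∑ p ∈ R.partitions (-lam), ((negQ ^ R.mExp p w : (ℤ[T;T⁻¹])ˣ) : ℤ[T;T⁻¹]) := by
  have hnegQ : (negQ : ℤ[T;T⁻¹]) = -LaurentPolynomial.T 1 := rfl
  have h1 : Polynomial.toLaurent (R.H (-(GCM.Realization.circ ρ w lam))) =
      ∑ p ∈ R.partitions (-GCM.Realization.circ ρ w lam),
        ((negQ ^ (p.card : ℤ) : (ℤ[T;T⁻¹])ˣ) : ℤ[T;T⁻¹]) := by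
    rw [R.H_eq_sum, map_sum]
    refine Finset.sum_congr rfl fun p _ => ?_
    rw [map_pow, map_neg, Polynomial.toLaurent_X, zpow_natCast, Units.val_pow_eq_pow_val, hnegQ]
  -- The bijection is applied with integer exponents of the unit `-q`, as `m(𝔭, w)` may be negative.
  rw [h1, GCM.Realization.sum_partitions_circ hρ lam hw
    fun k => ((negQ ^ k : (ℤ[T;T⁻¹])ˣ) : ℤ[T;T⁻¹])]
  simp only [zpow_add, Units.val_mul, ← Finset.mul_sum]
  rw [zpow_natCast, Units.val_pow_eq_pow_val, hnegQ, ← mul_assoc, ← mul_pow, neg_one_mul, neg_neg]
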